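/- An $n$-component link ($n\ge 1$) is given by a regular $C^1$ embedding $L\colon S^1\sqcup\dots\sqcup S^1\to\mathbb R^3$ of $n$ disjoint circles. Its length is the sum of the lengths of its components. Its thickness $\operatorname{Thi}(L)$ is twice its reach, where the reach is the largest $\epsilon$ such that every point of $\mathbb R^3$ at distance less than $\epsilon$ from (the image of) $L$ has a unique nearest point on $L$. Let $G$ be a compact subgroup of $\operatorname{Isom}(\mathbb R^3)$. A link $L$ is $G$-invariant if $g(L)=L$ (as point sets) for all $g\in G$, and oriented $G$-invariant if moreover the resulting action of $G$ on $L$ preserves the orientation of $L$. For an (oriented) $G$-invariant link $L$, the (oriented) symmetric link type $[L]_G$ is the set of all links that can be joined to $L$ by an isotopy through (oriented) $G$-invariant links, where an isotopy is a family $L_t$, $t\in[0,1]$, of links such that $L_t$ and its derivative along the circles are jointly continuous in $t$ and in the parameter. Proposition. Let $G$ be a compact subgroup of $\operatorname{Isom}(\mathbb R^3)$, let $L$ be a $G$-invariant link, and let $S$ be the set of links $L'\in[L]_G$ with $\operatorname{Thi}(L')\ge 1$. Then $S$ contains a link of minimal length: there is $L_0\in S$ with $\operatorname{Len}(L_0)\le\operatorname{Len}(L')$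 for all $L'\in S$ (in particular $S\neq\emptyset$). The same holds for oriented $G$-invariant links and oriented symmetric link types. -/

import Mathlib

/-- Euclidean three-space. -/
abbrev E3 : Type := EuclideanSpace ℝ (Fin 3)

/-- An `n`-component link in `ℝ³`, given by a regular `C¹` embedding of a disjoint union of `n`
circles `ℝ / ℤ`. The circles are handled through `1`-periodic maps on `ℝ`; the last field says that
the induced map on the disjoint union of the circles is injective. -/
structure Link (n : ℕ) where
  curve : Fin n → ℝ → E3
  periodic : ∀ i, Function.Periodic (curve i) 1
  contDiff : ∀ i, ContDiff ℝ 1 (curve i)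
  regular : ∀ i s, deriv (curve i) s ≠ 0
  embedded : ∀ i j s t, curve i s = curve j t → i = j ∧ ∃ k : ℤ, t = s + k

/-- The reach of a subset of `ℝ³`: the largest `ε` such that every point at distance less
than `ε` from the set has a unique nearest point in the set. -/
noncomputable def reach (K : Set E3) : ENNReal :=
  sSup {ε : ENNReal | ∀ p : E3, Metric.infEDist p K < ε →
    ∃! q : E3, q ∈ K ∧ edist p q = Metric.infEDist p K}

namespace Link

variable {n : ℕ}

/-- The point set of a link. -/
def carrier (L : Link n) : Set E3 := ⋃ i, Set.range (L.curve i)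

/-- The total length of a link. -/
noncomputable def length (L : Link n) : ℝ :=
  ∑ i, ∫ t in (0 : ℝ)..1, ‖deriv (L.curve i) t‖

/-- The thickness of a link is twice its reach. -/
noncomputable def thickness (L : Link n) : ENNReal := 2 * reach L.carrier

/-- The link is invariant under a group of isometries: the action on `ℝ³` restricts to an
action on the link. -/
def IsInvariant (G : Subgroup (E3 ≃ᵢ E3)) (L : Link n) : Prop :=
  ∀ g ∈ G, g '' L.carrier = L.carrier

/-- The action of `G` restricts to an orientation-preserving action on the link: every `g` in `G`
carries the oriented tangent direction at `x` to the oriented tangent direction at `g x`. -/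
def IsOrientedInvariant (G : Subgroup (E3 ≃ᵢ E3)) (L : Link n) : Prop :=
  L.IsInvariant G ∧ ∀ g ∈ G, ∀ i s j t, g (L.curve i s) = L.curve j t →
    SameRay ℝ (deriv (fun u => g (L.curve i u)) s) (deriv (L.curve j) t)

/-- `L` and `L'` are joined by a `C¹` isotopy of links, all of which satisfy `P`: the positions and
the derivatives along the curves depend jointly continuously on time and on the parameter. -/
def IsotopicThrough (P : Link n → Prop) (L L' : Link n) : Prop :=
  ∃ H : unitInterval → Link n, H 0 = L ∧ H 1 = L' ∧ (∀ τ, P (H τ)) ∧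
    (∀ i, Continuous fun p : unitInterval × ℝ => (H p.1).curve i p.2) ∧
    (∀ i, Continuous fun p : unitInterval × ℝ => deriv ((H p.1).curve i) p.2)

/-- The symmetric link type `[L]_G`: all links isotopic to `L` through `G`-invariant links. -/
def symmetricLinkType (G : Subgroup (E3 ≃ᵢ E3)) (L : Link n) : Set (Link n) :=
  {L' | IsotopicThrough (fun M => M.IsInvariant G) L L'}

/-- The oriented symmetric link type of `L`: all links isotopic to `L` through
oriented `G`-invariant links. -/
def orientedSymmetricLinkType (G : Subgroup (E3 ≃ᵢ E3)) (L : Link n) : Set (Link n) :=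
  {L' | IsotopicThrough (fun M => M.IsOrientedInvariant G) L L'}

end Link

/-- Compactness of a group of isometries of `ℝ³`, in the topology of pointwise convergence (which
on isometries is the compact-open topology, that is, the usual Lie group topology). -/
def IsCompactIsometryGroup (G : Subgroup (E3 ≃ᵢ E3)) : Prop :=
  IsCompact ((fun g : E3 ≃ᵢ E3 => (g : E3 → E3)) '' (G : Set (E3 ≃ᵢ E3)))

/-! The proof is the direct method of the calculus of variations, with extra care to stay inside one
symmetric isotopy class. Give every component constant speed, which does not change the point set.
An invariant link of this kind has a rigid action on parameters: each g in G sends curve i to curve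
j by s ↦ ε s + c with ε = ±1 (`IsInv.exists_action`), and ε = 1 in the oriented case. If two links
have the same such action, every curve on the straight segment between them has it too, because
isometries are affine. Hence C¹-close links with equal actions are isotopic through invariant links
(`exists_isotopicThrough_of_close`).

Thickness at least 1 is equivalent to the condition `Tube (1 / 2)`: open balls of radius 1/2 tangent
to the link miss it. This closed condition yields uniform estimates: tangents are Lipschitz
(`Tube.norm_deriv_sub_le`) and the curves are bi-Lipschitz with a constant depending only on the
radius (`Tube.biLip`). So the competitors of bounded length are compact in C¹ once they lie in a
fixed ball. That is arranged by grouping nearby components into clusters and translating the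
clusters towards a fixed point of G, equivariantly and without reducing the thickness below 1
(`exists_isotopicThrough_bounded`).

A minimizing sequence then has a C¹ limit, which is thick and invariant and whose length is the
infimum (`exists_limit`). The limit must still be shown isotopic to some member of the sequence.
Their actions on parameters agree up to small rotations, and these rotations form a cocycle. Taking
midranges of its values trivializes it, so a small shift of the parameters makes the actions equal
(`isotopicThrough_of_close`).

Competitors exist: averaging over small symmetric parameter windows makes the tangents Lipschitz,
hence the reach positive, and a homothety about a fixed point then enlarges the reach to 1/2
(`exists_isotopicThrough_tube`). -/

open Set Filter Topology

/-! ### Isotopies as paths in the C¹ topology -/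

namespace Link

variable {n : ℕ}

/-- Invariance under `G`, preserving the orientation in case `o` holds. -/
def IsInv (o : Prop) (G : Subgroup (E3 ≃ᵢ E3)) (L : Link n) : Prop :=
  L.IsInvariant G ∧ (o → ∀ g ∈ G, ∀ i s j t, g (L.curve i s) = L.curve j t →
    SameRay ℝ (deriv (fun u => g (L.curve i u)) s) (deriv (L.curve j) t))

theorem continuous_curve (L : Link n) (i : Fin n) : Continuous (L.curve i) :=
  (L.contDiff i).continuous

theorem differentiable_curve (L : Link n) (i : Fin n) : Differentiable ℝ (L.curve i) :=
  (L.contDiff i).differentiable one_ne_zero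

theorem continuous_deriv_curve (L : Link n) (i : Fin n) : Continuous (deriv (L.curve i)) :=
  (L.contDiff i).continuous_deriv le_rfl

theorem periodic_deriv {f : ℝ → E3} (hf : Function.Periodic f 1) :
    Function.Periodic (deriv f) 1 := by
  intro s
  rw [← deriv_comp_add_const]
  congr 1
  funext u
  exact hf u

/-- A link as a family of pairs of continuous maps, the curves and their derivatives. -/
noncomputable def toContinuousMaps (L : Link n) (i : Fin n) : C(ℝ, E3) × C(ℝ, E3) :=
  (⟨L.curve i, L.continuous_curve i⟩, ⟨deriv (L.curve i), L.continuous_deriv_curve i⟩)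

/-- The `C¹` topology on links. -/
noncomputable instance : TopologicalSpace (Link n) :=
  TopologicalSpace.induced toContinuousMaps inferInstance

/-- Currying for the compact-open topology: joint continuity in time and parameter is continuity
into `C(ℝ, E3)`, as ℝ is locally compact. Concatenation and reversal of isotopies then come from
paths. -/
theorem isotopicThrough_iff_joinedIn (P : Link n → Prop) (L L' : Link n) :
    IsotopicThrough P L L' ↔ JoinedIn {M | P M} L L' := by
  constructor
  · rintro ⟨H, h0, h1, hP, hc, hd⟩
    have hH : Continuous H := by
      refine continuous_induced_rng.2 (continuous_pi fun i => Continuous.prodMk ?_ ?_)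
      · exact (ContinuousMap.curry ⟨_, hc i⟩).continuous
      · exact (ContinuousMap.curry ⟨_, hd i⟩).continuous
    exact ⟨⟨⟨H, hH⟩, h0, h1⟩, hP⟩
  · rintro ⟨γ, hγ⟩
    have hc : Continuous fun τ => toContinuousMaps (γ τ) :=
      continuous_induced_dom.comp γ.continuous
    refine ⟨γ, γ.source, γ.target, hγ, fun i => ?_, fun i => ?_⟩
    · exact ContinuousMap.continuous_uncurry_of_continuous
        ⟨fun τ => (toContinuousMaps (γ τ) i).1, continuous_fst.comp ((continuous_apply i).comp hc)⟩
    · exact ContinuousMap.continuous_uncurry_of_continuous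
        ⟨fun τ => (toContinuousMaps (γ τ) i).2, continuous_snd.comp ((continuous_apply i).comp hc)⟩

theorem IsotopicThrough.trans {P : Link n → Prop} {L M N : Link n}
    (h : IsotopicThrough P L M) (h' : IsotopicThrough P M N) : IsotopicThrough P L N := by
  rw [isotopicThrough_iff_joinedIn] at *
  exact JoinedIn.trans h h'

theorem IsotopicThrough.symm {P : Link n → Prop} {L M : Link n}
    (h : IsotopicThrough P L M) : IsotopicThrough P M L := by
  rw [isotopicThrough_iff_joinedIn] at *
  exact JoinedIn.symm h

theorem IsotopicThrough.right {P : Link n → Prop} {L M : Link n}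
    (h : IsotopicThrough P L M) : P M := by
  obtain ⟨H, -, h1, hP, -⟩ := h
  exact h1 ▸ hP 1

end Link

/-! ### Isometries as affine maps -/

/-- The linear part of an isometry of `ℝ³`. -/
noncomputable def linearPart (g : E3 ≃ᵢ E3) : E3 ≃ₗᵢ[ℝ] E3 :=
  g.toRealAffineIsometryEquiv.linearIsometryEquiv

theorem linearPart_sub (g : E3 ≃ᵢ E3) (x y : E3) : linearPart g (x - y) = g x - g y := by
  have := g.toRealAffineIsometryEquiv.map_vsub x y
  simpa [linearPart] using this

theorem isometry_apply_eq (g : E3 ≃ᵢ E3) (x : E3) : g x = linearPart g x + g 0 := by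
  have := linearPart_sub g x 0
  rw [sub_zero] at this
  rw [this]; abel

theorem isometry_combination (g : E3 ≃ᵢ E3) (τ : ℝ) (x y : E3) :
    g ((1 - τ) • x + τ • y) = (1 - τ) • g x + τ • g y := by
  rw [isometry_apply_eq g ((1 - τ) • x + τ • y), isometry_apply_eq g x, isometry_apply_eq g y]
  simp only [map_add, map_smul]
  module

theorem hasDerivAt_isometry_comp (g : E3 ≃ᵢ E3) {f : ℝ → E3} {f' : E3} {s : ℝ}
    (hf : HasDerivAt f f' s) : HasDerivAt (fun u => g (f u)) (linearPart g f') s := by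
  have h : (fun u => g (f u)) = fun u => linearPart g (f u) + g 0 := by
    funext u; exact isometry_apply_eq g _
  rw [h]
  exact ((linearPart g).toContinuousLinearEquiv.toContinuousLinearMap.hasFDerivAt.comp_hasDerivAt
    s hf).add_const _

/-! ### Actions on parameters and straight-line isotopies -/

namespace Link

variable {n : ℕ} {o : Prop} {G : Subgroup (E3 ≃ᵢ E3)}

theorem periodic_int (L : Link n) (i : Fin n) (s : ℝ) (k : ℤ) :
    L.curve i (s + k) = L.curve i s := by
  simpa using (L.periodic i).int_mul k s

/-- `ε` is an admissible derivative of the action on the parameter circles. -/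
def IsSign (o : Prop) (ε : ℝ) : Prop := ε = 1 ∨ (ε = -1 ∧ ¬ o)

theorem IsSign.mul_self {ε : ℝ} (h : IsSign o ε) : ε * ε = 1 := by
  rcases h with rfl | ⟨rfl, -⟩ <;> norm_num

theorem IsSign.mul {ε ε' : ℝ} (h : IsSign o ε) (h' : IsSign o ε') : IsSign o (ε * ε') := by
  rcases h with rfl | ⟨rfl, ho⟩
  · simpa using h'
  · rcases h' with rfl | ⟨rfl, -⟩
    · exact Or.inr ⟨by norm_num, ho⟩
    · exact Or.inl (by norm_num)

theorem IsSign.abs {ε : ℝ} (h : IsSign o ε) : |ε| = 1 := by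
  rcases h with rfl | ⟨rfl, -⟩ <;> norm_num

theorem isInvariant_of_subset {L : Link n} (h : ∀ g ∈ G, g '' L.carrier ⊆ L.carrier) :
    L.IsInvariant G := by
  intro g hg
  refine (h g hg).antisymm fun x hx => ⟨g⁻¹ x, h _ (G.inv_mem hg) ⟨x, hx, rfl⟩, ?_⟩
  exact g.apply_symm_apply x

/-- Converse of `IsInv.exists_action`. When orientation counts, ε = 1, so g carries the velocity of
one curve exactly to the velocity of its image. -/
theorem isInv_of_action {M : Link n}
    (h : ∀ g ∈ G, ∀ i, ∃ j ε c, IsSign o ε ∧ ∀ s, g (M.curve i s) = M.curve j (ε * s + c)) :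
    IsInv o G M := by
  constructor
  · refine isInvariant_of_subset fun g hg => ?_
    rintro _ ⟨x, hx, rfl⟩
    obtain ⟨i, s, rfl⟩ := mem_iUnion.1 hx
    obtain ⟨j, ε, c, -, hj⟩ := h g hg i
    exact mem_iUnion.2 ⟨j, ε * s + c, (hj s).symm⟩
  · intro ho g hg i s j t hst
    obtain ⟨j', ε, c, hε, hj⟩ := h g hg i
    obtain rfl : ε = 1 := hε.resolve_right fun h => h.2 ho
    simp only [one_mul] at hj
    obtain ⟨rfl, k, rfl⟩ := M.embedded j' j (s + c) t ((hj s).symm.trans hst)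
    have h1 : deriv (fun u => g (M.curve i u)) s = deriv (M.curve j') (s + c) := by
      rw [← deriv_comp_add_const]
      congr 1
      funext u; exact hj u
    have h2 : deriv (M.curve j') (s + c + k) = deriv (M.curve j') (s + c) := by
      simpa using (periodic_deriv (M.periodic j')).int_mul k (s + c)
    rw [h1, h2]

/-- The straight-line isotopy between two links with the same action on the parameters. -/
theorem exists_isotopicThrough_segment (M : Link n) (γ : Fin n → ℝ → E3)
    (hper : ∀ i, Function.Periodic (γ i) 1) (hC : ∀ i, ContDiff ℝ 1 (γ i))
    (hreg : ∀ τ ∈ Icc (0 : ℝ) 1, ∀ i s,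
      (1 - τ) • deriv (M.curve i) s + τ • deriv (γ i) s ≠ 0)
    (hemb : ∀ τ ∈ Icc (0 : ℝ) 1, ∀ i j s t,
      (1 - τ) • M.curve i s + τ • γ i s = (1 - τ) • M.curve j t + τ • γ j t →
        i = j ∧ ∃ k : ℤ, t = s + k)
    (hact : ∀ g ∈ G, ∀ i, ∃ j ε c, IsSign o ε ∧
      (∀ s, g (M.curve i s) = M.curve j (ε * s + c)) ∧ ∀ s, g (γ i s) = γ j (ε * s + c)) :
    ∃ N : Link n, N.curve = γ ∧ IsotopicThrough (IsInv o G) M N := by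
  have hd : ∀ (τ : ℝ) i s, deriv (fun s => (1 - τ) • M.curve i s + τ • γ i s) s =
      (1 - τ) • deriv (M.curve i) s + τ • deriv (γ i) s := fun τ i s =>
    (((M.differentiable_curve i s).hasDerivAt.const_smul (1 - τ)).add
      ((((hC i).differentiable one_ne_zero) s).hasDerivAt.const_smul τ)).deriv
  let H : unitInterval → Link n := fun τ =>
    { curve := fun i s => (1 - (τ : ℝ)) • M.curve i s + (τ : ℝ) • γ i s
      periodic := fun i s => by simp only [M.periodic i s, hper i s]
      contDiff := fun i => ((M.contDiff i).const_smul _).add ((hC i).const_smul _)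
      regular := fun i s => by rw [hd]; exact hreg τ τ.2 i s
      embedded := hemb τ τ.2 }
  have h0 : H 0 = M := by
    cases M
    simp [H]
  refine ⟨H 1, by simp [H], H, h0, rfl, fun τ => ?_, fun i => ?_, fun i => ?_⟩
  -- Isometries preserve affine combinations, so the intermediate curves inherit the common action
  -- of the two ends.
  · refine isInv_of_action fun g hg i => ?_
    obtain ⟨j, ε, c, hε, h1, h2⟩ := hact g hg i
    exact ⟨j, ε, c, hε, fun s => by simp only [H, isometry_combination, h1, h2]⟩
  · have h1 := M.continuous_curve i
    have h2 := (hC i).continuous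
    simp only [H]
    fun_prop
  · have h1 := M.continuous_deriv_curve i
    have h2 := (hC i).continuous_deriv le_rfl
    simp only [H, hd]
    fun_prop

theorem eq_of_curve_eq {M N : Link n} (h : M.curve = N.curve) : M = N := by
  cases M; cases N; simpa using h

/-! ### Changes of parameter and constant speed -/

section Reparam

theorem add_int_of_add_one {φ : ℝ → ℝ} (h : ∀ s, φ (s + 1) = φ s + 1) (s : ℝ) (k : ℤ) :
    φ (s + k) = φ s + k := by
  have hp : Function.Periodic (fun s => φ s - s) 1 := fun s => by simp only [h]; ring
  have := hp.int_mul k s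
  simp only [mul_one] at this
  linarith

theorem surjective_of_add_one {φ : ℝ → ℝ} (hc : Continuous φ) (h : ∀ s, φ (s + 1) = φ s + 1) :
    Function.Surjective φ := by
  intro y
  have h1 := add_int_of_add_one h 0 ⌊y - φ 0⌋
  have h2 := add_int_of_add_one h 0 (⌊y - φ 0⌋ + 1)
  push_cast at h2
  rw [zero_add] at h1 h2
  have h3 := Int.floor_le (y - φ 0)
  have h4 := Int.lt_floor_add_one (y - φ 0)
  obtain ⟨x, -, hx⟩ := intermediate_value_Icc (show (⌊y - φ 0⌋ : ℝ) ≤ ⌊y - φ 0⌋ + 1 by linarith)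
    hc.continuousOn (show y ∈ Icc _ _ from ⟨by linarith, by linarith⟩)
  exact ⟨x, hx⟩

/-- Orientation-preserving changes of parameter of the circles, as maps on `ℝ`. -/
structure IsReparam (φ : Fin n → ℝ → ℝ) : Prop where
  contDiff : ∀ i, ContDiff ℝ 1 (φ i)
  deriv_pos : ∀ i s, 0 < deriv (φ i) s
  add_one : ∀ i s, φ i (s + 1) = φ i s + 1

theorem IsReparam.surjective {φ : Fin n → ℝ → ℝ} (h : IsReparam φ) (i : Fin n) :
    Function.Surjective (φ i) :=
  surjective_of_add_one (h.contDiff i).continuous (h.add_one i)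

theorem deriv_reparam (L : Link n) {φ : Fin n → ℝ → ℝ} (h : IsReparam φ) (i : Fin n) (s : ℝ) :
    deriv (fun s => L.curve i (φ i s)) s = deriv (φ i) s • deriv (L.curve i) (φ i s) :=
  deriv.scomp s (L.differentiable_curve i _) ((h.contDiff i).differentiable one_ne_zero s)

/-- The link with changed parameters. -/
def reparam (L : Link n) (φ : Fin n → ℝ → ℝ) (h : IsReparam φ) : Link n where
  curve i s := L.curve i (φ i s)
  periodic i s := by simp only [h.add_one, L.periodic i (φ i s)]
  contDiff i := (L.contDiff i).comp (h.contDiff i)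
  regular i s := by
    rw [deriv_reparam L h]
    exact smul_ne_zero (h.deriv_pos i s).ne' (L.regular _ _)
  embedded i j s t hst := by
    obtain ⟨rfl, k, hk⟩ := L.embedded _ _ _ _ hst
    rw [← add_int_of_add_one (h.add_one i)] at hk
    exact ⟨rfl, k, (strictMono_of_deriv_pos (h.deriv_pos i)).injective hk⟩

theorem carrier_reparam (L : Link n) (φ : Fin n → ℝ → ℝ) (h : IsReparam φ) :
    (L.reparam φ h).carrier = L.carrier :=
  iUnion_congr fun i => (h.surjective i).range_comp (L.curve i)

theorem IsInv.reparam {L : Link n} (hL : IsInv o G L) (φ : Fin n → ℝ → ℝ) (h : IsReparam φ) :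
    IsInv o G (L.reparam φ h) := by
  refine ⟨fun g hg => by rw [carrier_reparam]; exact hL.1 g hg, fun ho g hg i s j t hst => ?_⟩
  have h1 := hL.2 ho g hg i (φ i s) j (φ j t) hst
  have h2 : deriv (fun u => g ((L.reparam φ h).curve i u)) s =
      deriv (φ i) s • deriv (fun u => g (L.curve i u)) (φ i s) :=
    deriv.scomp (h := φ i) s
      (hasDerivAt_isometry_comp g (L.differentiable_curve i (φ i s)).hasDerivAt).differentiableAt
      ((h.contDiff i).differentiable one_ne_zero s)
  have h3 : deriv ((L.reparam φ h).curve j) t = deriv (φ j) t • deriv (L.curve j) (φ j t) :=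
    deriv_reparam L h j t
  rw [h2, h3]
  exact (h1.pos_smul_left (h.deriv_pos i s)).pos_smul_right (h.deriv_pos j t)

/-- Changes of parameter form a convex set containing the identity; along the segment to φ the point
set and the orientation stay fixed, so invariance is automatic. -/
theorem IsInv.isotopicThrough_reparam {L : Link n} (hL : IsInv o G L) (φ : Fin n → ℝ → ℝ)
    (h : IsReparam φ) : IsotopicThrough (IsInv o G) L (L.reparam φ h) := by
  have hd : ∀ (τ : ℝ) i s, deriv (fun s => (1 - τ) * s + τ * φ i s) s =
      (1 - τ) + τ * deriv (φ i) s := fun τ i s => by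
    have h1 := ((hasDerivAt_id s).const_mul (1 - τ)).add
      (((h.contDiff i).differentiable one_ne_zero s).hasDerivAt.const_mul τ)
    rw [mul_one] at h1
    exact h1.deriv
  have hr : ∀ τ : unitInterval,
      IsReparam fun (i : Fin n) s => (1 - (τ : ℝ)) * s + (τ : ℝ) * φ i s := fun τ =>
    { contDiff := fun i => (contDiff_const.mul contDiff_id).add
        (contDiff_const.mul (h.contDiff i))
      deriv_pos := fun i s => by
        rw [hd]
        have h1 := h.deriv_pos i s
        rcases eq_or_lt_of_le τ.2.2 with h2 | h2
        · rw [h2]; linarith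
        · have := mul_nonneg τ.2.1 h1.le
          linarith
      add_one := fun i s => by simp only [h.add_one]; ring }
  refine ⟨fun τ => L.reparam _ (hr τ), ?_, ?_, fun τ => hL.reparam _ _, fun i => ?_, fun i => ?_⟩
  · exact eq_of_curve_eq (by funext i s; simp [Link.reparam])
  · exact eq_of_curve_eq (by funext i s; simp [Link.reparam])
  · have h1 := L.continuous_curve i
    have h2 := (h.contDiff i).continuous
    simp only [Link.reparam]
    fun_prop
  · have h1 := L.continuous_deriv_curve i
    have h2 := (h.contDiff i).continuous
    have h3 := (h.contDiff i).continuous_deriv le_rfl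
    have : (fun p : unitInterval × ℝ => deriv ((L.reparam _ (hr p.1)).curve i) p.2) =
        fun p : unitInterval × ℝ => ((1 - (p.1 : ℝ)) + p.1 * deriv (φ i) p.2) •
          deriv (L.curve i) ((1 - (p.1 : ℝ)) * p.2 + p.1 * φ i p.2) := by
      funext p
      rw [← hd]
      exact deriv_reparam L (hr p.1) i p.2
    rw [this]
    fun_prop

/-- All components are parametrized with constant speed `v i`. -/
def HasSpeed (L : Link n) (v : Fin n → ℝ) : Prop :=
  (∀ i, 0 < v i) ∧ ∀ i s, ‖deriv (L.curve i) s‖ = v i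

theorem HasSpeed.length_eq {L : Link n} {v : Fin n → ℝ} (h : L.HasSpeed v) :
    L.length = ∑ i, v i := by
  simp [Link.length, h.2]

/-- φ is the inverse of the primitive of f. Since f has integral one over a period, the primitive
commutes with the shift by one. For f the speed divided by the length, composing with φ gives
constant speed. -/
theorem exists_arclength_reparam {f : ℝ → ℝ} (hf : Continuous f) (hpos : ∀ s, 0 < f s)
    (hper : Function.Periodic f 1) (hint : ∫ s in (0 : ℝ)..1, f s = 1) :
    ∃ φ : ℝ → ℝ, ContDiff ℝ 1 φ ∧ (∀ s, φ (s + 1) = φ s + 1) ∧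
      ∀ s, deriv φ s = (f (φ s))⁻¹ := by
  set σ : ℝ → ℝ := fun s => ∫ u in (0 : ℝ)..s, f u with hσ
  have hd : ∀ s, HasDerivAt σ (f s) s := fun s => hf.integral_hasStrictDerivAt 0 s |>.hasDerivAt
  have hσ1 : ∀ s, σ (s + 1) = σ s + 1 := fun s => by
    have h1 := intervalIntegral.integral_add_adjacent_intervals (μ := MeasureTheory.volume)
      (hf.intervalIntegrable 0 s) (hf.intervalIntegrable s (s + 1))
    have h2 := hper.intervalIntegral_add_eq s 0
    rw [zero_add, hint] at h2
    simp only [hσ, ← h1, h2]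
  have hmono : StrictMono σ := strictMono_of_deriv_pos fun s => by rw [(hd s).deriv]; exact hpos s
  have hsurj := surjective_of_add_one
    (continuous_iff_continuousAt.2 fun s => (hd s).continuousAt) hσ1
  let e : ℝ ≃ₜ ℝ := (hmono.orderIsoOfSurjective σ hsurj).toHomeomorph
  have he : ∀ s, σ (e.symm s) = s := fun s => e.apply_symm_apply s
  have hder : ∀ s, HasDerivAt e.symm (f (e.symm s))⁻¹ s := fun s =>
    (hd (e.symm s)).of_local_left_inverse e.symm.continuous.continuousAt (hpos _).ne'
      (Eventually.of_forall he)
  refine ⟨e.symm, ?_, fun s => hmono.injective ?_, fun s => (hder s).deriv⟩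
  · refine contDiff_one_iff_deriv.2 ⟨fun s => (hder s).differentiableAt, ?_⟩
    rw [show deriv e.symm = _ from funext fun s => (hder s).deriv]
    exact (hf.comp e.symm.continuous).inv₀ fun s => (hpos _).ne'
  · rw [hσ1, he, he]

/-- Every invariant link can be isotoped, as an invariant link and within its point set, to a link
with components of constant speed. -/
theorem IsInv.exists_hasSpeed {L : Link n} (hL : IsInv o G L) :
    ∃ (M : Link n) (v : Fin n → ℝ), IsotopicThrough (IsInv o G) L M ∧ M.carrier = L.carrier ∧
      M.HasSpeed v ∧ M.length = L.length := by
  have hc : ∀ i, Continuous fun s => ‖deriv (L.curve i) s‖ := fun i =>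
    (L.continuous_deriv_curve i).norm
  have hp : ∀ i s, 0 < ‖deriv (L.curve i) s‖ := fun i s => norm_pos_iff.2 (L.regular i s)
  set ℓ : Fin n → ℝ := fun i => ∫ t in (0 : ℝ)..1, ‖deriv (L.curve i) t‖ with hℓ
  have hℓpos : ∀ i, 0 < ℓ i := fun i =>
    intervalIntegral.intervalIntegral_pos_of_pos ((hc i).intervalIntegrable 0 1) (hp i) one_pos
  have : ∀ i, ∃ φ : ℝ → ℝ, ContDiff ℝ 1 φ ∧ (∀ s, φ (s + 1) = φ s + 1) ∧
      ∀ s, deriv φ s = (‖deriv (L.curve i) (φ s)‖ / ℓ i)⁻¹ := fun i => by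
    refine exists_arclength_reparam (f := fun s => ‖deriv (L.curve i) s‖ / ℓ i)
      ((hc i).div_const _) (fun s => div_pos (hp i s) (hℓpos i))
      (fun s => by simp only [periodic_deriv (L.periodic i) s]) ?_
    rw [intervalIntegral.integral_div]
    exact div_self (hℓpos i).ne'
  choose φ h1 h2 h3 using this
  have hφ : IsReparam φ := ⟨h1, fun i s => by
    rw [h3]; exact inv_pos.2 (div_pos (hp _ _) (hℓpos i)), h2⟩
  have hs : (L.reparam φ hφ).HasSpeed ℓ := by
    refine ⟨hℓpos, fun i s => ?_⟩
    have h4 : deriv ((L.reparam φ hφ).curve i) s = _ := deriv_reparam L hφ i s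
    have := (hp i (φ i s)).ne'
    have := (hℓpos i).ne'
    rw [h4, norm_smul, h3, norm_inv, norm_div, norm_norm, Real.norm_of_nonneg (hℓpos i).le]
    field_simp
  exact ⟨_, ℓ, hL.isotopicThrough_reparam φ hφ, carrier_reparam _ _ _, hs, hs.length_eq⟩

end Reparam

end Link

/-! ### The action on parameters of a constant-speed link -/

namespace Link

variable {n : ℕ} {o : Prop} {G : Subgroup (E3 ≃ᵢ E3)}

theorem isCompact_range_curve (L : Link n) (i : Fin n) : IsCompact (range (L.curve i)) :=
  (L.periodic i).compact_of_continuous one_ne_zero (L.continuous_curve i)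

/-- The components are finitely many disjoint closed sets, so their preimages in the connected line
are clopen. -/
theorem exists_component_of_continuous (L : Link n) {f : ℝ → E3} (hf : Continuous f)
    (h : ∀ s, f s ∈ L.carrier) : ∃ j, ∀ s, f s ∈ range (L.curve j) := by
  have hcl : ∀ j, IsClosed (f ⁻¹' range (L.curve j)) := fun j =>
    (L.isCompact_range_curve j).isClosed.preimage hf
  obtain ⟨j, hj⟩ := mem_iUnion.1 (h 0)
  have hcompl : (f ⁻¹' range (L.curve j))ᶜ = ⋃ k ∈ {k : Fin n | k ≠ j}, f ⁻¹' range (L.curve k) := by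
    ext s
    simp only [mem_compl_iff, mem_preimage, mem_iUnion, mem_ofPred_eq, exists_prop]
    constructor
    · intro hs
      obtain ⟨k, hk⟩ := mem_iUnion.1 (h s)
      exact ⟨k, fun e => hs (e ▸ hk), hk⟩
    · rintro ⟨k, hkj, u, hu⟩ ⟨t, ht⟩
      exact hkj (L.embedded k j u t (hu.trans ht.symm)).1
  have hopen : IsOpen (f ⁻¹' range (L.curve j)) := by
    rw [← isClosed_compl_iff, hcompl]
    exact (Set.toFinite _).isClosed_biUnion fun k _ => hcl k
  have := IsClopen.eq_univ (s := f ⁻¹' range (L.curve j)) ⟨hcl j, hopen⟩ ⟨0, hj⟩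
  exact ⟨j, fun s => by
    have : s ∈ f ⁻¹' range (L.curve j) := by rw [this]; trivial
    exact this⟩

/-- A curve in a link lifts to the parameter line of a component. -/
theorem exists_continuous_lift (L : Link n) {f : ℝ → E3} (hf : Continuous f)
    (h : ∀ s, f s ∈ L.carrier) :
    ∃ j, ∃ φ : ℝ → ℝ, Continuous φ ∧ ∀ s, f s = L.curve j (φ s) := by
  obtain ⟨j, hj⟩ := L.exists_component_of_continuous hf h
  let F : AddCircle (1 : ℝ) → E3 := (L.periodic j).lift
  have hFc : Continuous F := (L.continuous_curve j).quotient_lift _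
  have hFi : Function.Injective F := by
    intro x y
    induction x using QuotientAddGroup.induction_on with | _ x => ?_
    induction y using QuotientAddGroup.induction_on with | _ y => ?_
    intro hxy
    obtain ⟨-, k, rfl⟩ := L.embedded j j x y hxy
    exact QuotientAddGroup.eq.2 ⟨k, by simp⟩
  -- The circle is compact, so F is an embedding; f thus gives a continuous map to the circle, which
  -- lifts through the covering by ℝ.
  have hemb := (hFc.isClosedEmbedding hFi).isEmbedding
  choose t ht using hj
  have hcont : Continuous fun s => (t s : AddCircle (1 : ℝ)) := by
    rw [hemb.continuous_iff]
    exact hf.congr fun s => (ht s).symm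
  obtain ⟨φ, ⟨-, hφ⟩, -⟩ := (AddCircle.isCoveringMap_coe (1 : ℝ)).existsUnique_continuousMap_lifts
    ⟨_, hcont⟩ 0 (t 0) rfl
  refine ⟨j, φ, φ.continuous, fun s => ?_⟩
  have := congrFun hφ s
  exact (ht s).symm.trans (congrArg F this).symm

/-- Project to the tangent line at the point: t ↦ ⟨w, L.curve j t⟩ has strict derivative ‖w‖² ≠ 0
there, hence a differentiable local inverse, and by continuity φ is this inverse composed with ⟨w,
f⟩. -/
theorem differentiable_lift (L : Link n) {f : ℝ → E3} (hf : Differentiable ℝ f) {j : Fin n}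
    {φ : ℝ → ℝ} (hφ : Continuous φ) (h : ∀ s, f s = L.curve j (φ s)) : Differentiable ℝ φ := by
  intro s
  set w := deriv (L.curve j) (φ s)
  have hstrict : HasStrictDerivAt (fun t => inner ℝ w (L.curve j t)) (inner ℝ w w) (φ s) := by
    have h1 := ((L.contDiff j).contDiffAt (x := φ s)).hasStrictDerivAt one_ne_zero
    exact (innerSL ℝ w).hasStrictFDerivAt.comp_hasStrictDerivAt (φ s) h1
  have hne : (inner ℝ w w : ℝ) ≠ 0 := inner_self_ne_zero.2 (L.regular j _)
  have h2 := (hstrict.to_localInverse hne).hasDerivAt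
  have h3 : DifferentiableAt ℝ (fun u => (inner ℝ w (f u) : ℝ)) s :=
    (differentiableAt_const w).inner ℝ (hf s)
  have h4 : (inner ℝ w (f s) : ℝ) = inner ℝ w (L.curve j (φ s)) := by rw [h]
  rw [← h4] at h2
  have h5 := DifferentiableAt.comp s h2.differentiableAt h3
  refine h5.congr_of_eventuallyEq ?_
  have h6 := hφ.continuousAt.eventually
    ((hstrict.hasStrictFDerivAt_equiv hne).eventually_left_inverse)
  filter_upwards [h6] with u hu
  simp only [Function.comp_apply, h u]
  exact hu.symm

/-- Lift g ∘ curve i to curve j ∘ φ. Constant speeds make |φ'| constant, so φ is affine; its slope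
is an integer by periodicity, and a unit by injectivity. -/
theorem IsInv.exists_action {M : Link n} {v : Fin n → ℝ} (hM : IsInv o G M) (hv : M.HasSpeed v) :
    ∀ g ∈ G, ∀ i, ∃ j ε c, IsSign o ε ∧ ∀ s, g (M.curve i s) = M.curve j (ε * s + c) := by
  intro g hg i
  set f : ℝ → E3 := fun s => g (M.curve i s) with hf
  have hfd : ∀ s, HasDerivAt f (linearPart g (deriv (M.curve i) s)) s := fun s =>
    hasDerivAt_isometry_comp g (M.differentiable_curve i s).hasDerivAt
  obtain ⟨j, φ, hφ, hfφ⟩ := M.exists_continuous_lift (f := f)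
    (continuous_iff_continuousAt.2 fun s => (hfd s).continuousAt) fun s => by
      rw [← hM.1 g hg]
      exact mem_image_of_mem _ (mem_iUnion.2 ⟨i, s, rfl⟩)
  have hφd := M.differentiable_lift (fun s => (hfd s).differentiableAt) hφ hfφ
  have hder : ∀ s, linearPart g (deriv (M.curve i) s) =
      deriv φ s • deriv (M.curve j) (φ s) := fun s => by
    have h1 := HasDerivAt.scomp s (M.differentiable_curve j (φ s)).hasDerivAt (hφd s).hasDerivAt
    refine (hfd s).unique (h1.congr_of_eventuallyEq (Eventually.of_forall fun u => hfφ u))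
  have habs : ∀ s, |deriv φ s| = v i / v j := fun s => by
    have := congrArg norm (hder s)
    rw [LinearIsometryEquiv.norm_map, norm_smul, hv.2, hv.2, Real.norm_eq_abs] at this
    rw [this, mul_div_cancel_right₀ _ (hv.1 j).ne']
  have hpos : 0 < v i / v j := div_pos (hv.1 i) (hv.1 j)
  have hne : ∀ s, deriv φ s ≠ 0 := fun s => abs_pos.1 (by rw [habs]; exact hpos)
  obtain ⟨ρ, hρ⟩ : ∃ ρ, ∀ s, deriv φ s = ρ := by
    -- Darboux: a nonvanishing derivative has constant sign, so continuity of φ' is not required.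
    rcases hasDerivWithinAt_forall_lt_or_forall_gt_of_forall_ne (s := univ) convex_univ
      (fun x _ => (hφd x).hasDerivAt.hasDerivWithinAt) (m := 0) (fun x _ => hne x) with h | h
    · exact ⟨-(v i / v j), fun s => by rw [← habs s, abs_of_neg (h s trivial), neg_neg]⟩
    · exact ⟨v i / v j, fun s => by rw [← habs s, abs_of_pos (h s trivial)]⟩
  have hlin : ∀ s, φ s = ρ * s + φ 0 := by
    have h1 : ∀ s, HasDerivAt (fun s => φ s - ρ * s) 0 s := fun s => by
      have := (hφd s).hasDerivAt.sub ((hasDerivAt_id s).const_mul ρ)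
      rwa [hρ, mul_one, sub_self] at this
    intro s
    have := is_const_of_deriv_eq_zero (fun s => (h1 s).differentiableAt) (fun s => (h1 s).deriv) s 0
    simp only [mul_zero, sub_zero] at this
    linarith
  obtain ⟨k, hk⟩ : ∃ k : ℤ, ρ = k := by
    have h1 : M.curve j (φ 0) = M.curve j (φ 1) := by
      rw [← hfφ, ← hfφ, hf]
      simp only
      rw [← M.periodic i 0, zero_add]
    obtain ⟨-, k, hk⟩ := M.embedded _ _ _ _ h1
    exact ⟨k, by rw [hlin 1] at hk; linarith⟩
  have hρ0 : (k : ℝ) ≠ 0 := by rw [← hk, ← hρ 0]; exact hne 0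
  have hunit : IsUnit k := by
    -- Parameters 0 and 1/k have the same image because φ moves by exactly one between them; so 1/k
    -- is an integer.
    have h1 : f 0 = f (1 / k) := by
      rw [hfφ, hfφ, hlin (1 / k), hk, mul_one_div_cancel hρ0, add_comm, M.periodic j]
    obtain ⟨-, m, hm⟩ := M.embedded i i 0 (1 / k) (g.injective h1)
    refine IsUnit.of_mul_eq_one m ?_
    rw [zero_add, div_eq_iff hρ0] at hm
    rw [mul_comm]
    exact_mod_cast hm.symm
  refine ⟨j, ρ, φ 0, ?_, fun s => by rw [← hlin]; exact hfφ s⟩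
  rcases Int.isUnit_iff.1 hunit with rfl | rfl
  · exact Or.inl (by simpa using hk)
  · have hk' : ρ = -1 := by simpa using hk
    refine Or.inr ⟨hk', fun ho => ?_⟩
    -- Slope -1 would put a nonzero tangent vector and its negative on one ray.
    have h1 := hM.2 ho g hg i 0 j (φ 0) (hfφ 0)
    rw [(hfd 0).deriv, hder, hρ, hk', neg_one_smul] at h1
    exact M.regular j _ (eq_zero_of_sameRay_self_neg h1.symm)

end Link

/-! ### Nearest points to a compact set of positive reach -/

section NearestPoint

variable {K : Set E3} {r : ℝ}

theorem ofReal_le_reach_iff (hK : K.Nonempty) (r : ℝ) :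
    ENNReal.ofReal r ≤ reach K ↔ ∀ p, Metric.infDist p K < r →
      ∃! q, q ∈ K ∧ dist p q = Metric.infDist p K := by
  have he : ∀ p q : E3, edist p q = Metric.infEDist p K ↔ dist p q = Metric.infDist p K :=
    fun p q => by
      rw [Metric.infDist, dist_edist,
        ENNReal.toReal_eq_toReal_iff' (edist_ne_top _ _) (Metric.infEDist_ne_top hK)]
  have hlt : ∀ p, Metric.infEDist p K < ENNReal.ofReal r ↔ Metric.infDist p K < r := fun p => by
    rw [Metric.infDist, ENNReal.lt_ofReal_iff_toReal_lt (Metric.infEDist_ne_top hK)]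
  constructor
  · intro h p hp
    obtain ⟨ε, hε, hpε⟩ := lt_sSup_iff.1 (((hlt p).2 hp).trans_le h)
    simpa only [he] using hε p hpε
  · intro h
    refine le_sSup fun p hp => ?_
    simpa only [he] using h p ((hlt p).1 hp)

/-- Every cluster point of π x as x → p lies in K and realizes the distance from p, so uniqueness
and compactness give convergence. -/
theorem tendsto_nearest (hK : IsCompact K) {π : E3 → E3}
    (hπ : ∀ x, π x ∈ K ∧ dist x (π x) = Metric.infDist x K) {p : E3}
    (hU : ∃! q, q ∈ K ∧ dist p q = Metric.infDist p K) :
    Tendsto π (𝓝 p) (𝓝 (π p)) := by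
  refine hK.tendsto_nhds_of_unique_mapClusterPt (Eventually.of_forall fun x => (hπ x).1)
    fun y hy hc => hU.unique ⟨hy, ?_⟩ (hπ p)
  obtain ⟨U, hU, hUy⟩ := mapClusterPt_iff_ultrafilter.1 hc
  have hUx : Tendsto (fun x : E3 => x) U (𝓝 p) := hU
  have h1 : Tendsto (fun x => dist x (π x)) U (𝓝 (dist p y)) := hUx.dist hUy
  have h2 : Tendsto (fun x => dist x (π x)) U (𝓝 (Metric.infDist p K)) := by
    simp only [fun x => (hπ x).2]
    exact (Metric.continuous_infDist_pt K).continuousAt.tendsto.comp hUx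
  exact tendsto_nhds_unique h1 h2

/-- The distance from a set increases at unit speed away from the unique nearest point. -/
theorem eventually_infDist_ascent (hK : IsCompact K) (hne : K.Nonempty) {p a : E3}
    (hU : ∃! q, q ∈ K ∧ dist p q = Metric.infDist p K)
    (ha : a ∈ K ∧ dist p a = Metric.infDist p K) (hpos : 0 < Metric.infDist p K)
    {θ : ℝ} (hθ : θ < 1) :
    ∀ᶠ h in 𝓝[>] (0 : ℝ), Metric.infDist p K + h * (θ * Metric.infDist p K) ≤
      Metric.infDist (p + h • (p - a)) K := by
  have hex : ∀ x, ∃ y, y ∈ K ∧ dist x y = Metric.infDist x K := fun x => by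
    obtain ⟨y, hy, h⟩ := hK.exists_infDist_eq_dist hne x
    exact ⟨y, hy, h.symm⟩
  choose π hπ using hex
  set δ := Metric.infDist p K with hδ
  have hπp : π p = a := hU.unique (hπ p) ha
  have hpa : ‖p - a‖ = δ := by rw [← dist_eq_norm]; exact ha.2
  have hx : Tendsto (fun h : ℝ => p + h • (p - a)) (𝓝[>] 0) (𝓝 p) := by
    have : Continuous fun h : ℝ => p + h • (p - a) := by fun_prop
    simpa using (this.tendsto 0).mono_left nhdsWithin_le_nhds
  have hy : Tendsto (fun h : ℝ => π (p + h • (p - a))) (𝓝[>] 0) (𝓝 a) := by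
    have := (tendsto_nearest hK hπ hU).comp hx
    rwa [hπp] at this
  have hlim : Tendsto (fun h : ℝ => (inner ℝ (p - a) (p - π (p + h • (p - a))) : ℝ) /
      ‖p - π (p + h • (p - a))‖) (𝓝[>] 0) (𝓝 δ) := by
    have h1 : Tendsto (fun h : ℝ => p - π (p + h • (p - a))) (𝓝[>] 0) (𝓝 (p - a)) :=
      hy.const_sub p
    have h2 := (tendsto_const_nhds (x := p - a)).inner h1 (𝕜 := ℝ) |>.div h1.norm
      (by rw [hpa]; exact hpos.ne')
    rw [real_inner_self_eq_norm_sq, hpa, sq, mul_div_cancel_right₀ _ hpos.ne'] at h2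
    exact h2
  filter_upwards [hlim.eventually_const_lt (show θ * δ < δ by nlinarith), self_mem_nhdsWithin]
    with h hh hpos'
  set y := π (p + h • (p - a))
  have hyn : δ ≤ ‖p - y‖ := by
    rw [← dist_eq_norm]; exact Metric.infDist_le_dist_of_mem (hπ _).1
  have hyp : 0 < ‖p - y‖ := hpos.trans_le hyn
  rw [← (hπ (p + h • (p - a))).2, dist_eq_norm]
  -- Cauchy–Schwarz against p - y bounds the new distance from below by ‖p - y‖ + h⟨p - a, p - y⟩/‖p
  -- - y‖; the last quotient tends to δ.
  have h3 := real_inner_le_norm (p + h • (p - a) - y) (p - y)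
  have h4 : p + h • (p - a) - y = (p - y) + h • (p - a) := by abel
  rw [h4, inner_add_left, real_inner_smul_left, real_inner_self_eq_norm_sq, ← h4] at h3
  have h5 : ‖p - y‖ + h * ((inner ℝ (p - a) (p - y) : ℝ) / ‖p - y‖) ≤ ‖p + h • (p - a) - y‖ := by
    rw [← mul_le_mul_iff_left₀ hyp]
    calc _ = ‖p - y‖ ^ 2 + h * inner ℝ (p - a) (p - y) := by field_simp
      _ ≤ _ := h3
  have h6 := mul_le_mul_of_nonneg_left hh.le (le_of_lt hpos')
  linarith

/-- The distance has ascent rate one wherever it is positive and below r, so its maximum over the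
ball of radius s about p is its value at p plus s. Equality in the triangle inequality then forces
the maximizer onto the ray from a through p. -/
theorem infDist_ray (hK : IsCompact K) (hne : K.Nonempty)
    (hU : ∀ p, Metric.infDist p K < r → ∃! q, q ∈ K ∧ dist p q = Metric.infDist p K)
    {p a : E3} (ha : a ∈ K ∧ dist p a = Metric.infDist p K) (hpos : 0 < Metric.infDist p K)
    {s : ℝ} (hs : 0 ≤ s) (hsr : Metric.infDist p K + s < r) :
    Metric.infDist (p + (s / Metric.infDist p K) • (p - a)) K = Metric.infDist p K + s := by
  set δ := Metric.infDist p K with hδ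
  have hpa : ‖p - a‖ = δ := by rw [← dist_eq_norm]; exact ha.2
  have hcont := Metric.continuous_infDist_pt K
  have hball := isCompact_closedBall p s
  have hbne : (Metric.closedBall p s).Nonempty := ⟨p, Metric.mem_closedBall_self hs⟩
  have hle : ∀ x ∈ Metric.closedBall p s, Metric.infDist x K ≤ δ + s := fun x hx => by
    have := Metric.infDist_le_infDist_add_dist (s := K) (x := x) (y := p)
    linarith [Metric.mem_closedBall.1 hx]
  obtain ⟨y, hy, hymax⟩ := hball.exists_isMaxOn hbne hcont.continuousOn
  have hθ : ∀ θ ∈ Ioo (0 : ℝ) 1, δ + θ * s ≤ Metric.infDist y K := by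
    intro θ hθ
    -- Penalize the distance to p with slope θ < 1. An interior maximizer could still be improved by
    -- moving away from its nearest point at rate (1 + θ)/2 > θ, so the maximizer lies on the
    -- sphere.
    obtain ⟨x, hx, hxmax⟩ := hball.exists_isMaxOn hbne
      (f := fun x => Metric.infDist x K - θ * dist x p) (by fun_prop)
    have hxp : δ ≤ Metric.infDist x K - θ * dist x p := by
      have := hxmax (Metric.mem_closedBall_self hs)
      simpa using this
    have hxs : dist x p = s := by
      by_contra hne'
      have hlt : dist x p < s := lt_of_le_of_ne hx hne'
      have hx0 : 0 < Metric.infDist x K := by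
        have := mul_nonneg hθ.1.le (dist_nonneg (x := x) (y := p))
        linarith
      have hxU := hU x ((hle x hx).trans_lt hsr)
      obtain ⟨b, hb, hbx⟩ := hK.exists_infDist_eq_dist hne x
      have hxb : ‖x - b‖ = Metric.infDist x K := by rw [← dist_eq_norm]; exact hbx.symm
      have h1 := eventually_infDist_ascent hK hne hxU ⟨hb, hbx.symm⟩ hx0
        (θ := (1 + θ) / 2) (by linarith [hθ.2])
      have h2 : ∀ᶠ h in 𝓝[>] (0 : ℝ), dist (x + h • (x - b)) p < s := by
        have hc : Continuous fun h : ℝ => dist (x + h • (x - b)) p := by fun_prop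
        refine nhdsWithin_le_nhds (hc.continuousAt.eventually_lt continuousAt_const ?_)
        simpa using hlt
      obtain ⟨h, h1, h2, h3⟩ := (h1.and (h2.and self_mem_nhdsWithin)).exists
      have h3 : 0 < h := h3
      have h4 := hxmax (Metric.mem_closedBall.2 h2.le)
      simp only [mem_ofPred_eq] at h4
      have h5 : dist (x + h • (x - b)) p ≤ dist x p + h * Metric.infDist x K := by
        have := dist_triangle (x + h • (x - b)) x p
        rw [dist_eq_norm (x + h • (x - b)) x, add_sub_cancel_left, norm_smul,
          Real.norm_of_nonneg h3.le, hxb] at this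
        linarith
      have h6 := mul_le_mul_of_nonneg_left h5 hθ.1.le
      have h7 : 0 < h * Metric.infDist x K * (1 - θ) :=
        mul_pos (mul_pos h3 hx0) (by linarith [hθ.2])
      nlinarith
    have := hymax hx
    simp only [mem_ofPred_eq] at this
    rw [hxs] at hxp
    linarith
  have hyδ : δ + s ≤ Metric.infDist y K := by
    have h1 : Tendsto (fun θ : ℝ => δ + θ * s) (𝓝[<] 1) (𝓝 (δ + 1 * s)) := by
      have : Continuous fun θ : ℝ => δ + θ * s := by fun_prop
      exact (this.tendsto 1).mono_left nhdsWithin_le_nhds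
    rw [one_mul] at h1
    exact le_of_tendsto h1 (by filter_upwards [Ioo_mem_nhdsLT one_pos] with θ h using hθ θ h)
  have hya : Metric.infDist y K ≤ ‖(y - p) + (p - a)‖ := by
    rw [sub_add_sub_cancel, ← dist_eq_norm]
    exact Metric.infDist_le_dist_of_mem ha.1
  have hyp : ‖y - p‖ ≤ s := by rw [← dist_eq_norm]; exact hy
  have htri := norm_add_le (y - p) (p - a)
  have hys : ‖y - p‖ = s := by linarith
  have hray : SameRay ℝ (y - p) (p - a) := sameRay_iff_norm_add.2 (by linarith)
  have heq := sameRay_iff_norm_smul_eq.1 hray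
  rw [hys, hpa] at heq
  have : p + (s / δ) • (p - a) = y := by
    rw [div_eq_inv_mul, mul_smul, heq, smul_smul, inv_mul_cancel₀ hpos.ne', one_smul]
    abel
  rw [this]
  exact (hle y hy).antisymm hyδ

/-- The ball of radius `r` touching a set of reach `r` at a nearest point avoids the set. -/
theorem inner_le_of_nearest (hK : IsCompact K) (hne : K.Nonempty)
    (hU : ∀ p, Metric.infDist p K < r → ∃! q, q ∈ K ∧ dist p q = Metric.infDist p K)
    {p a q : E3} (ha : a ∈ K ∧ dist p a = Metric.infDist p K) (hr : Metric.infDist p K < r)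
    (hq : q ∈ K) : 2 * r * inner ℝ (q - a) (p - a) ≤ ‖q - a‖ ^ 2 * ‖p - a‖ := by
  have hpa : ‖p - a‖ = Metric.infDist p K := by rw [← dist_eq_norm]; exact ha.2
  rcases (Metric.infDist_nonneg (x := p) (s := K)).eq_or_lt with h0 | hpos
  · rw [← h0, norm_eq_zero] at hpa
    simp [hpa]
  set δ := Metric.infDist p K with hδ
  -- The point of the ray at distance t from a is still at distance t from K, so q is outside the
  -- open t-ball around it. Expanding the square gives the inequality, and t tends to r.
  have key : ∀ t ∈ Ioo δ r, 2 * t * inner ℝ (q - a) (p - a) ≤ ‖q - a‖ ^ 2 * ‖p - a‖ := by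
    intro t ht
    have h1 := infDist_ray hK hne hU ha hpos (s := t - δ) (by linarith [ht.1])
      (by rw [← hδ]; linarith [ht.2])
    rw [← hδ] at h1
    have h2 : p + ((t - δ) / δ) • (p - a) - q = (t / δ) • (p - a) - (q - a) := by
      rw [sub_div, div_self hpos.ne']
      module
    have h3 := Metric.infDist_le_dist_of_mem (x := p + ((t - δ) / δ) • (p - a)) hq
    rw [h1, dist_eq_norm, h2, add_sub_cancel] at h3
    have ht0 : 0 < t := hpos.trans ht.1
    have h4 := pow_le_pow_left₀ ht0.le h3 2
    rw [norm_sub_sq_real, norm_smul, hpa, Real.norm_of_nonneg (by positivity),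
      div_mul_cancel₀ _ hpos.ne', real_inner_smul_left, real_inner_comm] at h4
    have h5 : 2 * (t / δ * inner ℝ (q - a) (p - a)) ≤ ‖q - a‖ ^ 2 := by linarith
    rw [hpa]
    calc 2 * t * inner ℝ (q - a) (p - a) = 2 * (t / δ * inner ℝ (q - a) (p - a)) * δ := by
          field_simp
      _ ≤ _ := mul_le_mul_of_nonneg_right h5 hpos.le
  have hlim : Tendsto (fun t : ℝ => 2 * t * inner ℝ (q - a) (p - a)) (𝓝[<] r)
      (𝓝 (2 * r * inner ℝ (q - a) (p - a))) := by
    have : Continuous fun t : ℝ => 2 * t * (inner ℝ (q - a) (p - a) : ℝ) := by fun_prop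
    exact (this.tendsto r).mono_left nhdsWithin_le_nhds
  exact le_of_tendsto hlim (by filter_upwards [Ioo_mem_nhdsLT hr] with t ht using key t ht)

end NearestPoint

/-! ### Thickness and empty tangent balls -/

namespace Link

variable {n : ℕ}

theorem isCompact_carrier (L : Link n) : IsCompact L.carrier :=
  isCompact_iUnion L.isCompact_range_curve

theorem carrier_nonempty (L : Link n) (i : Fin n) : L.carrier.Nonempty :=
  ⟨L.curve i 0, mem_iUnion.2 ⟨i, 0, rfl⟩⟩

theorem curve_mem_carrier (L : Link n) (i : Fin n) (s : ℝ) : L.curve i s ∈ L.carrier :=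
  mem_iUnion.2 ⟨i, s, rfl⟩

theorem exists_near (L : Link n) (s : ℝ) {x : E3} (hx : x ∈ L.carrier) :
    ∃ j, ∃ t ∈ Icc (s - 1 / 2) (s + 1 / 2), x = L.curve j t := by
  obtain ⟨j, t, rfl⟩ := mem_iUnion.1 hx
  refine ⟨j, t + (-round (t - s) : ℤ), ?_, (L.periodic_int j t _).symm⟩
  have := abs_le.1 (abs_sub_round (t - s))
  push_cast
  constructor <;> linarith [this.1, this.2]

/-- Choose parameters within 1/2 of s. A cluster point of them represents the same point of the
link, so it differs from s by an integer of absolute value at most 1/2, which is 0. -/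
theorem exists_tendsto_parameter (L : Link n) {ι : Type*} {l : Filter ι} {a : ι → E3}
    (ha : ∀ h, a h ∈ L.carrier) {i : Fin n} {s : ℝ} (hlim : Tendsto a l (𝓝 (L.curve i s))) :
    ∃ t : ι → ℝ, Tendsto t l (𝓝 s) ∧ ∀ᶠ h in l, a h = L.curve i (t h) := by
  choose j t ht hat using fun h => L.exists_near s (ha h)
  have hcomp : IsCompact ((univ : Set (Fin n)) ×ˢ Icc (s - 1 / 2) (s + 1 / 2)) :=
    isCompact_univ.prod isCompact_Icc
  have hjt : Tendsto (fun h => (j h, t h)) l (𝓝 (i, s)) := by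
    refine hcomp.tendsto_nhds_of_unique_mapClusterPt
      (Eventually.of_forall fun h => ⟨trivial, ht h⟩) ?_
    rintro ⟨j', t'⟩ hy hc
    obtain ⟨U, hU, hUy⟩ := mapClusterPt_iff_ultrafilter.1 hc
    have h1 : ∀ᶠ h in (U : Filter ι), j h = j' := by
      have := (continuous_fst.tendsto (j', t')).comp hUy
      rwa [nhds_discrete, tendsto_pure] at this
    have h2 : Tendsto t U (𝓝 t') := (continuous_snd.tendsto (j', t')).comp hUy
    have h3 : Tendsto a U (𝓝 (L.curve j' t')) := by
      refine (((L.continuous_curve j').tendsto t').comp h2).congr' ?_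
      filter_upwards [h1] with h hh
      rw [hat h, ← hh]; rfl
    have h4 := tendsto_nhds_unique (hlim.mono_left hU) h3
    obtain ⟨rfl, k, hk⟩ := L.embedded _ _ _ _ h4
    have h5 : |(k : ℝ)| ≤ 1 / 2 := abs_le.2 ⟨by linarith [hy.2.1], by linarith [hy.2.2]⟩
    have h6 : |k| < 1 := by
      have : |(k : ℝ)| < 1 := by linarith
      exact_mod_cast this
    rw [Int.abs_lt_one_iff] at h6
    simp [hk, h6]
  refine ⟨t, (continuous_snd.tendsto (i, s)).comp hjt, ?_⟩
  have h1 : ∀ᶠ h in l, j h = i := by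
    have := (continuous_fst.tendsto (i, s)).comp hjt
    rwa [nhds_discrete, tendsto_pure] at this
  filter_upwards [h1] with h hh
  rw [hat h, hh]

/-- The open balls of radius `r` tangent to the link do not meet it. -/
def Tube (r : ℝ) (L : Link n) : Prop :=
  ∀ i s j t, ∀ w : E3, inner ℝ (deriv (L.curve i) s) w = 0 →
    2 * r * inner ℝ (L.curve j t - L.curve i s) w ≤
      ‖L.curve j t - L.curve i s‖ ^ 2 * ‖w‖

theorem inner_deriv_eq_zero_of_isLocalMin (L : Link n) {i : Fin n} {s : ℝ} {p : E3}
    (h : IsLocalMin (fun t => ‖p - L.curve i t‖ ^ 2) s) :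
    inner ℝ (deriv (L.curve i) s) (p - L.curve i s) = 0 := by
  have h1 := (((L.differentiable_curve i s).hasDerivAt.const_sub p).norm_sq)
  have := h.hasDerivAt_eq_zero h1
  rw [inner_neg_right] at this
  rw [real_inner_comm]
  linarith

theorem inner_deriv_eq_zero_of_nearest (L : Link n) {i : Fin n} {s : ℝ} {p : E3}
    (h : dist p (L.curve i s) = Metric.infDist p L.carrier) :
    inner ℝ (deriv (L.curve i) s) (p - L.curve i s) = 0 := by
  refine L.inner_deriv_eq_zero_of_isLocalMin (Eventually.of_forall fun t => ?_)
  simp only [← dist_eq_norm, h]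
  exact pow_le_pow_left₀ Metric.infDist_nonneg
    (Metric.infDist_le_dist_of_mem (L.curve_mem_carrier i t)) 2

/-- `inner_le_of_nearest` covers only normals that point to some p from its nearest point, and for a
C¹ curve a given normal w need not obviously arise so. Move q₀ by h w, take the nearest point a h,
and write the difference as h b(h); then b(h) → w and the inequality passes to the limit. -/
theorem tube_of_unique_nearest (L : Link n) {r : ℝ} (hr : 0 < r)
    (hU : ∀ p, Metric.infDist p L.carrier < r →
      ∃! q, q ∈ L.carrier ∧ dist p q = Metric.infDist p L.carrier) : L.Tube r := by
  intro i s j t w hw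
  have hK := L.isCompact_carrier
  have hne := L.carrier_nonempty i
  have hex : ∀ x, ∃ y, y ∈ L.carrier ∧ dist x y = Metric.infDist x L.carrier := fun x => by
    obtain ⟨y, hy, h⟩ := hK.exists_infDist_eq_dist hne x
    exact ⟨y, hy, h.symm⟩
  choose π hπ using hex
  set q₀ := L.curve i s with hq₀
  set a : ℝ → E3 := fun h => π (q₀ + h • w) with ha
  have hp : Tendsto (fun h : ℝ => q₀ + h • w) (𝓝[>] 0) (𝓝 q₀) := by
    have : Continuous fun h : ℝ => q₀ + h • w := by fun_prop
    simpa using (this.tendsto 0).mono_left nhdsWithin_le_nhds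
  have hd0 : Metric.infDist q₀ L.carrier = 0 :=
    Metric.infDist_zero_of_mem (L.curve_mem_carrier i s)
  have hπ0 : π q₀ = q₀ := by
    have := (hπ q₀).2
    rw [hd0, dist_eq_zero] at this
    exact this.symm
  have halim : Tendsto a (𝓝[>] 0) (𝓝 q₀) := by
    have := (tendsto_nearest hK hπ (hU q₀ (by rw [hd0]; exact hr))).comp hp
    rwa [hπ0] at this
  obtain ⟨τ, hτ, hτa⟩ := L.exists_tendsto_parameter (a := a) (fun h => (hπ _).1) halim
  set T := deriv (L.curve i) s with hT
  have hD : Tendsto (fun h => dslope (L.curve i) s (τ h)) (𝓝[>] 0) (𝓝 T) := by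
    have := (continuousAt_dslope_same.2 (L.differentiable_curve i s)).tendsto.comp hτ
    rwa [dslope_same] at this
  have hT' : Tendsto (fun h => deriv (L.curve i) (τ h)) (𝓝[>] 0) (𝓝 T) :=
    ((L.continuous_deriv_curve i).tendsto s).comp hτ
  have hTT : (inner ℝ T T : ℝ) ≠ 0 := inner_self_ne_zero.2 (L.regular i s)
  -- This quotient equals (τ h - s)/h, by orthogonality at the nearest point. It tends to 0 because
  -- w is normal to T; `dslope` also covers τ h = s.
  have hκ : Tendsto (fun h => (inner ℝ (deriv (L.curve i) (τ h)) w : ℝ) /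
      inner ℝ (deriv (L.curve i) (τ h)) (dslope (L.curve i) s (τ h))) (𝓝[>] 0) (𝓝 0) := by
    have := (hT'.inner (𝕜 := ℝ) (tendsto_const_nhds (x := w))).div (hT'.inner (𝕜 := ℝ) hD) hTT
    rwa [hw, zero_div] at this
  have hne0 : ∀ᶠ h in 𝓝[>] (0 : ℝ),
      (inner ℝ (deriv (L.curve i) (τ h)) (dslope (L.curve i) s (τ h)) : ℝ) ≠ 0 :=
    (hT'.inner (𝕜 := ℝ) hD).eventually_ne hTT
  set b : ℝ → E3 := fun h => w - ((inner ℝ (deriv (L.curve i) (τ h)) w : ℝ) /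
      inner ℝ (deriv (L.curve i) (τ h)) (dslope (L.curve i) s (τ h))) •
        dslope (L.curve i) s (τ h) with hb
  have hblim : Tendsto b (𝓝[>] 0) (𝓝 w) := by
    simpa using (hκ.smul hD).const_sub w
  have hpb : ∀ᶠ h in 𝓝[>] (0 : ℝ), q₀ + h • w - a h = h • b h := by
    filter_upwards [hτa, hne0, self_mem_nhdsWithin] with h h1 h2 h3
    have h3 : h ≠ 0 := ne_of_gt h3
    have h4 : a h - q₀ = (τ h - s) • dslope (L.curve i) s (τ h) := by
      rw [sub_smul_dslope, h1]
    have h5 := L.inner_deriv_eq_zero_of_nearest (i := i) (s := τ h) (p := q₀ + h • w)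
      (by rw [← h1]; exact (hπ _).2)
    have h6 : q₀ + h • w - a h = h • w - (τ h - s) • dslope (L.curve i) s (τ h) := by
      rw [← h4]; abel
    rw [← h1, h6, inner_sub_right, real_inner_smul_right, real_inner_smul_right] at h5
    have h7 : τ h - s = h * ((inner ℝ (deriv (L.curve i) (τ h)) w : ℝ) /
        inner ℝ (deriv (L.curve i) (τ h)) (dslope (L.curve i) s (τ h))) := by
      rw [← mul_div_assoc, eq_div_iff h2]
      linarith
    rw [h6, h7, hb, mul_smul, smul_sub]
  have hdist : ∀ᶠ h in 𝓝[>] (0 : ℝ), Metric.infDist (q₀ + h • w) L.carrier < r := by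
    have := (Metric.continuous_infDist_pt L.carrier).continuousAt.tendsto.comp hp
    rw [hd0] at this
    exact this.eventually_lt_const hr
  have hineq : ∀ᶠ h in 𝓝[>] (0 : ℝ), 2 * r * inner ℝ (L.curve j t - a h) (b h) ≤
      ‖L.curve j t - a h‖ ^ 2 * ‖b h‖ := by
    filter_upwards [hpb, hdist, self_mem_nhdsWithin] with h h1 h2 h3
    have h3 : 0 < h := h3
    have h4 := inner_le_of_nearest hK hne hU (hπ (q₀ + h • w)) h2 (L.curve_mem_carrier j t)
    have h5 : q₀ + h • w - π (q₀ + h • w) = h • b h := h1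
    rw [h5, real_inner_smul_right, norm_smul, Real.norm_of_nonneg h3.le] at h4
    refine le_of_mul_le_mul_left ?_ h3
    calc _ = 2 * r * (h * inner ℝ (L.curve j t - a h) (b h)) := by ring
      _ ≤ _ := h4
      _ = _ := by ring
  have hl : Tendsto (fun h => L.curve j t - a h) (𝓝[>] 0) (𝓝 (L.curve j t - q₀)) :=
    halim.const_sub _
  exact le_of_tendsto_of_tendsto ((hl.inner (𝕜 := ℝ) hblim).const_mul (2 * r))
    ((hl.norm.pow 2).mul hblim.norm) hineq

/-- For nearest points a and q at distance δ, equidistance gives ‖q - a‖² = 2⟨q - a, p - a⟩, and the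
tube inequality at a gives r‖q - a‖² ≤ δ‖q - a‖². As δ < r, q = a. -/
theorem Tube.unique_nearest {L : Link n} {r : ℝ} (hL : L.Tube r) (hne : L.carrier.Nonempty)
    (p : E3) (hp : Metric.infDist p L.carrier < r) :
    ∃! q, q ∈ L.carrier ∧ dist p q = Metric.infDist p L.carrier := by
  obtain ⟨a, ha, hpa⟩ := L.isCompact_carrier.exists_infDist_eq_dist hne p
  refine ⟨a, ⟨ha, hpa.symm⟩, ?_⟩
  rintro q ⟨hq, hpq⟩
  obtain ⟨i, s, rfl⟩ := mem_iUnion.1 ha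
  obtain ⟨j, t, rfl⟩ := mem_iUnion.1 hq
  have h1 := hL i s j t _ (L.inner_deriv_eq_zero_of_nearest hpa.symm)
  rw [dist_eq_norm] at hpq hpa
  have h2 : p - L.curve j t = (p - L.curve i s) - (L.curve j t - L.curve i s) := by abel
  have h3 := norm_sub_sq_real (p - L.curve i s) (L.curve j t - L.curve i s)
  rw [← h2, hpq, ← hpa, real_inner_comm] at h3
  rw [← hpa] at h1
  set δ := Metric.infDist p L.carrier
  have hδ : 0 ≤ δ := Metric.infDist_nonneg
  have h4 : ‖L.curve j t - L.curve i s‖ ^ 2 * (r - δ) ≤ 0 := by nlinarith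
  have h5 : ‖L.curve j t - L.curve i s‖ ^ 2 ≤ 0 := by nlinarith
  have h6 : ‖L.curve j t - L.curve i s‖ = 0 := pow_eq_zero_iff two_ne_zero |>.1
    (h5.antisymm (sq_nonneg _))
  exact sub_eq_zero.1 (norm_eq_zero.1 h6)

theorem one_le_thickness_iff_tube (L : Link n) (hn : 1 ≤ n) :
    1 ≤ L.thickness ↔ L.Tube (1 / 2) := by
  have hne := L.carrier_nonempty ⟨0, hn⟩
  have h1 : 1 ≤ L.thickness ↔ ENNReal.ofReal (1 / 2) ≤ reach L.carrier := by
    rw [Link.thickness, one_div, ENNReal.ofReal_inv_of_pos two_pos, ENNReal.ofReal_ofNat,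
      ENNReal.inv_le_iff_le_mul (by simp) (by simp)]
  rw [h1, ofReal_le_reach_iff hne]
  exact ⟨L.tube_of_unique_nearest (by norm_num), fun h p hp => h.unique_nearest hne p hp⟩

end Link

/-! ### Lipschitz estimates and quantitative embeddedness -/

theorem exists_pos_forall_le {ι : Type*} [Finite ι] (f : ι → ℝ) (h : ∀ i, 0 < f i) :
    ∃ c > 0, ∀ i, c ≤ f i := by
  cases isEmpty_or_nonempty ι
  · exact ⟨1, one_pos, fun i => isEmptyElim i⟩
  · obtain ⟨i, hi⟩ := Finite.exists_min f
    exact ⟨f i, h i, hi⟩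

theorem uniformContinuous_of_periodic {f : ℝ → E3} (hf : Continuous f)
    (hp : Function.Periodic f 1) : UniformContinuous f := by
  let F : AddCircle (1 : ℝ) → E3 := hp.lift
  have hF : UniformContinuous F :=
    CompactSpace.uniformContinuous_of_continuous (hf.quotient_lift _)
  have hc : UniformContinuous ((↑) : ℝ → AddCircle (1 : ℝ)) :=
    uniformContinuous_of_continuousAt_zero (QuotientAddGroup.mk' (AddSubgroup.zmultiples (1 : ℝ)))
      (AddCircle.continuous_mk' (1 : ℝ)).continuousAt
  exact hF.comp hc

theorem norm_sub_sub_smul_le {f : ℝ → E3} (hf : Differentiable ℝ f) {s t C : ℝ} {T : E3}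
    (h : ∀ x ∈ uIcc s t, ‖deriv f x - T‖ ≤ C) :
    ‖f t - f s - (t - s) • T‖ ≤ C * |t - s| := by
  have hd : ∀ x, HasDerivAt (fun x => f x - x • T) (deriv f x - T) x := fun x => by
    have := (hf x).hasDerivAt.sub ((hasDerivAt_id x).smul_const T)
    rwa [one_smul] at this
  have := (convex_uIcc s t).norm_image_sub_le_of_norm_hasDerivWithin_le
    (fun x _ => (hd x).hasDerivWithinAt) h left_mem_uIcc right_mem_uIcc
  rw [Real.norm_eq_abs] at this
  rwa [show f t - t • T - (f s - s • T) = f t - f s - (t - s) • T by module] at this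

theorem norm_sub_le_of_norm_deriv_le {f : ℝ → E3} (hf : Differentiable ℝ f) {C : ℝ}
    (h : ∀ x, ‖deriv f x‖ ≤ C) (s t : ℝ) : ‖f t - f s‖ ≤ C * |t - s| := by
  simpa using norm_sub_sub_smul_le hf (s := s) (t := t) (T := 0) fun x _ => by simpa using h x

/-- Subdivide the interval; the induction splits off one piece of relative length 1/(N + 1). Steps
of η/2 keep each piece strictly shorter than η. -/
theorem norm_sub_le_of_local {f : ℝ → E3} {η K : ℝ} (hη : 0 < η)
    (h : ∀ s t, |t - s| < η → ‖f t - f s‖ ≤ K * |t - s|) (s t : ℝ) :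
    ‖f t - f s‖ ≤ K * |t - s| := by
  have key : ∀ N : ℕ, ∀ s t, |t - s| ≤ N * (η / 2) → ‖f t - f s‖ ≤ K * |t - s| := by
    intro N
    induction N with
    | zero =>
      intro s t hst
      exact h s t (by simp only [Nat.cast_zero, zero_mul] at hst; linarith)
    | succ N ih =>
      intro s t hst
      push_cast at hst
      have hN : (0 : ℝ) < N + 1 := by positivity
      have h1 : s + (t - s) * (N / (N + 1)) - s = (t - s) * (N / (N + 1)) := by ring
      have h2 : t - (s + (t - s) * (N / (N + 1))) = (t - s) * (1 / (N + 1)) := by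
        field_simp; ring
      have a1 : |s + (t - s) * (N / (N + 1)) - s| = |t - s| * (N / (N + 1)) := by
        rw [h1, abs_mul, abs_of_nonneg (by positivity : (0 : ℝ) ≤ N / (N + 1))]
      have a2 : |t - (s + (t - s) * (N / (N + 1)))| = |t - s| * (1 / (N + 1)) := by
        rw [h2, abs_mul, abs_of_nonneg (by positivity : (0 : ℝ) ≤ 1 / (N + 1))]
      have b1 := ih s (s + (t - s) * (N / (N + 1))) (by
        rw [a1, mul_div_assoc', div_le_iff₀ hN]
        nlinarith [(Nat.cast_nonneg N : (0 : ℝ) ≤ N)])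
      have b2 := h (s + (t - s) * (N / (N + 1))) t (by
        rw [a2, mul_one_div, div_lt_iff₀ hN]
        nlinarith)
      rw [a1] at b1
      rw [a2] at b2
      have b3 := norm_add_le (f t - f (s + (t - s) * (N / (N + 1))))
        (f (s + (t - s) * (N / (N + 1))) - f s)
      rw [sub_add_sub_cancel] at b3
      calc _ ≤ _ := b3
        _ ≤ K * (|t - s| * (1 / (N + 1))) + K * (|t - s| * (N / (N + 1))) := add_le_add b2 b1
        _ = _ := by field_simp; ring
  obtain ⟨N, hN⟩ := exists_nat_gt (|t - s| / (η / 2))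
  exact key N s t ((div_lt_iff₀ (by positivity)).1 hN).le

/-- Quantitative embeddedness of a family of closed curves. -/
structure BiLip {n : ℕ} (c : ℝ) (γ : Fin n → ℝ → E3) : Prop where
  near : ∀ i s t, |t - s| ≤ 1 / 2 → c * |t - s| ≤ ‖γ i t - γ i s‖
  far : ∀ i j, i ≠ j → ∀ s t, c ≤ ‖γ i t - γ j s‖

/-- Closeness of families of curves in the `C¹` sense. -/
structure C1Close {n : ℕ} (d : ℝ) (γ η : Fin n → ℝ → E3) : Prop where
  pos : ∀ i s, ‖γ i s - η i s‖ ≤ d / 2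
  deriv : ∀ i s, ‖deriv (γ i) s - deriv (η i) s‖ ≤ d

section

variable {n : ℕ} {c d : ℝ} {γ η : Fin n → ℝ → E3}

theorem BiLip.embedded (h : BiLip c γ) (hc : 0 < c) (hper : ∀ i, Function.Periodic (γ i) 1)
    (i j : Fin n) (s t : ℝ) (hst : γ i s = γ j t) : i = j ∧ ∃ k : ℤ, t = s + k := by
  obtain rfl : i = j := by
    by_contra hij
    have := h.far i j hij t s
    rw [hst, sub_self, norm_zero] at this
    linarith
  refine ⟨rfl, round (t - s), ?_⟩
  have h1 : γ i (s + round (t - s)) = γ i s := by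
    simpa using (hper i).int_mul (round (t - s)) s
  have h2 := h.near i (s + round (t - s)) t (by
    rw [← sub_sub]; exact abs_sub_round _)
  rw [h1, hst, sub_self, norm_zero] at h2
  have h3 : |t - (s + round (t - s))| ≤ 0 := by
    by_contra h'
    have := mul_pos hc (not_le.1 h')
    linarith
  have := abs_nonpos_iff.1 h3
  linarith

theorem BiLip.le_norm_deriv (h : BiLip c γ) (hd : ∀ i, Differentiable ℝ (γ i)) (i : Fin n)
    (s : ℝ) : c ≤ ‖deriv (γ i) s‖ := by
  have h1 := (hasDerivAt_iff_tendsto_slope.1 (hd i s).hasDerivAt).norm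
  refine ge_of_tendsto h1 ?_
  have h2 : ∀ᶠ t in 𝓝[≠] s, |t - s| < 1 / 2 :=
    nhdsWithin_le_nhds (Metric.ball_mem_nhds s (by norm_num))
  filter_upwards [h2, self_mem_nhdsWithin] with t ht hts
  have h3 : 0 < |t - s| := abs_pos.2 (sub_ne_zero.2 hts)
  rw [slope_def_module, norm_smul, norm_inv, Real.norm_eq_abs, ← div_eq_inv_mul,
    le_div_iff₀ h3]
  exact h.near i s t ht.le

theorem C1Close.norm_sub_sub_le (h : C1Close d γ η) (hγ : ∀ i, Differentiable ℝ (γ i))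
    (hη : ∀ i, Differentiable ℝ (η i)) (i : Fin n) (s t : ℝ) :
    ‖(γ i t - η i t) - (γ i s - η i s)‖ ≤ d * |t - s| :=
  norm_sub_le_of_norm_deriv_le (f := fun t => γ i t - η i t) ((hγ i).sub (hη i)) (fun x => by
    have := ((hγ i x).hasDerivAt.sub (hη i x).hasDerivAt).deriv
    rw [show (fun t => γ i t - η i t) = γ i - η i from rfl, this]
    exact h.deriv i x) s t

/-- On one component the difference of the curves is d-Lipschitz; between components two position
errors of d/2 add up to d. -/
theorem BiLip.of_close (h : BiLip c γ) (hd : C1Close d γ η) (hγ : ∀ i, Differentiable ℝ (γ i))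
    (hη : ∀ i, Differentiable ℝ (η i)) : BiLip (c - d) η where
  near i s t hst := by
    have h1 := h.near i s t hst
    have h2 := hd.norm_sub_sub_le hγ hη i s t
    have h3 := norm_add_le (η i t - η i s) ((γ i t - η i t) - (γ i s - η i s))
    rw [show η i t - η i s + ((γ i t - η i t) - (γ i s - η i s)) = γ i t - γ i s by abel] at h3
    linarith
  far i j hij s t := by
    have h1 := h.far i j hij s t
    have h2 := hd.pos i t
    have h3 := hd.pos j s
    have h4 := norm_add₃_le (a := η i t - η j s) (b := γ i t - η i t) (c := -(γ j s - η j s))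
    rw [show η i t - η j s + (γ i t - η i t) + -(γ j s - η j s) = γ i t - γ j s by abel,
      norm_neg] at h4
    linarith

end

/-! ### C¹-close links and bi-Lipschitz constants -/

namespace Link

variable {n : ℕ} {o : Prop} {G : Subgroup (E3 ≃ᵢ E3)}

/-- A family of curves that is `C¹`-close to a link and has the same action of the group on the
parameters is a link isotopic to the given one. -/
theorem exists_isotopicThrough_of_close (M : Link n) (γ : Fin n → ℝ → E3)
    (hper : ∀ i, Function.Periodic (γ i) 1) (hC : ∀ i, ContDiff ℝ 1 (γ i)) {c d : ℝ}
    (hM : BiLip c M.curve) (hd : C1Close d M.curve γ) (hdc : d < c)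
    (hact : ∀ g ∈ G, ∀ i, ∃ j ε c, IsSign o ε ∧
      (∀ s, g (M.curve i s) = M.curve j (ε * s + c)) ∧ ∀ s, g (γ i s) = γ j (ε * s + c)) :
    ∃ N : Link n, N.curve = γ ∧ IsotopicThrough (IsInv o G) M N ∧ BiLip (c - d) N.curve := by
  have hγ : ∀ i, Differentiable ℝ (γ i) := fun i => (hC i).differentiable one_ne_zero
  have hder : ∀ (τ : ℝ) i s, deriv (fun s => (1 - τ) • M.curve i s + τ • γ i s) s =
      (1 - τ) • deriv (M.curve i) s + τ • deriv (γ i) s := fun τ i s =>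
    (((M.differentiable_curve i s).hasDerivAt.const_smul (1 - τ)).add
      ((hγ i s).hasDerivAt.const_smul τ)).deriv
  have hdiff : ∀ (τ : ℝ) i, Differentiable ℝ fun s => (1 - τ) • M.curve i s + τ • γ i s :=
    fun τ i => by
      have h1 := M.differentiable_curve i
      have h2 := hγ i
      fun_prop
  -- Each stage of the segment is as close to M as γ is. The resulting bi-Lipschitz constant c - d >
  -- 0 gives both regularity and embeddedness.
  have hbi : ∀ τ ∈ Icc (0 : ℝ) 1,
      BiLip (c - d) fun i s => (1 - τ) • M.curve i s + τ • γ i s := fun τ hτ => by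
    have hx : ∀ (x y : E3) (e : ℝ), ‖x - y‖ ≤ e → ‖x - ((1 - τ) • x + τ • y)‖ ≤ e :=
      fun x y e h => by
        rw [show x - ((1 - τ) • x + τ • y) = τ • (x - y) by module, norm_smul,
          Real.norm_of_nonneg hτ.1]
        nlinarith [norm_nonneg (x - y), hτ.2]
    refine hM.of_close ⟨fun i s => hx _ _ _ (hd.pos i s), fun i s => ?_⟩ M.differentiable_curve
      (hdiff τ)
    rw [hder]
    exact hx _ _ _ (hd.deriv i s)
  have hpos : 0 < c - d := sub_pos.2 hdc
  obtain ⟨N, rfl, hN⟩ := M.exists_isotopicThrough_segment γ hper hC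
    (fun τ hτ i s => by
      rw [← hder]
      exact norm_pos_iff.1 (hpos.trans_le ((hbi τ hτ).le_norm_deriv (hdiff τ) i s)))
    (fun τ hτ => (hbi τ hτ).embedded hpos fun i s => by
      simp only [M.periodic i s, hper i s]) hact
  refine ⟨N, rfl, hN, ?_⟩
  simpa using hbi 1 ⟨zero_le_one, le_rfl⟩

theorem uniformContinuous_deriv_curve (L : Link n) (i : Fin n) :
    UniformContinuous (deriv (L.curve i)) :=
  uniformContinuous_of_periodic (L.continuous_deriv_curve i) (periodic_deriv (L.periodic i))

theorem curve_fract (L : Link n) (i : Fin n) (s t : ℝ) :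
    L.curve i (t - ⌊s⌋) = L.curve i t := by
  have := L.periodic_int i t (-⌊s⌋)
  push_cast at this
  rwa [← sub_eq_add_neg] at this

/-- At short parameter distance the tangent is nearly constant; at the remaining distances, and
between components, compactness and injectivity give a positive minimum. -/
theorem HasSpeed.exists_biLip {L : Link n} {v : Fin n → ℝ} (hv : L.HasSpeed v) :
    ∃ c > 0, BiLip c L.curve := by
  have hnear : ∀ i, ∃ c > 0, ∀ s t, |t - s| ≤ 1 / 2 →
      c * |t - s| ≤ ‖L.curve i t - L.curve i s‖ := by
    intro i
    obtain ⟨η, hη, hu⟩ := Metric.uniformContinuous_iff.1 (L.uniformContinuous_deriv_curve i)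
      (v i / 2) (half_pos (hv.1 i))
    have hc : Continuous (L.curve i) := L.continuous_curve i
    have hK : IsCompact ((Icc (0 : ℝ) 1 ×ˢ Icc (-1 / 2 : ℝ) (1 / 2)) ∩ {p | η ≤ |p.2|}) :=
      (isCompact_Icc.prod isCompact_Icc).inter_right
        (isClosed_le continuous_const (continuous_abs.comp continuous_snd))
    obtain ⟨m, hm, hmin⟩ := hK.exists_forall_le'
      (f := fun p : ℝ × ℝ => ‖L.curve i (p.1 + p.2) - L.curve i p.1‖) (a := 0)
      (by fun_prop) (by
        rintro ⟨s, h⟩ ⟨⟨-, h2⟩, h3⟩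
        refine norm_pos_iff.2 (sub_ne_zero.2 fun he => ?_)
        obtain ⟨-, k, hk⟩ := L.embedded i i s (s + h) he.symm
        have hk' : h = k := by linarith
        have h3 : η ≤ |h| := h3
        have h4 : |h| ≤ 1 / 2 := abs_le.2 ⟨by linarith [h2.1], h2.2⟩
        have h5 : |k| < 1 := by
          have : |(k : ℝ)| < 1 := by rw [← hk']; linarith
          exact_mod_cast this
        rw [Int.abs_lt_one_iff] at h5
        rw [hk', h5, Int.cast_zero, abs_zero] at h3
        linarith)
    refine ⟨min (v i / 2) m, lt_min (half_pos (hv.1 i)) hm, fun s t hst => ?_⟩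
    rcases lt_or_ge |t - s| η with hlt | hge
    · have h1 := norm_sub_sub_smul_le (L.differentiable_curve i) (s := s) (t := t)
        (T := deriv (L.curve i) s) (C := v i / 2) fun x hx => by
          rw [← dist_eq_norm]
          refine (hu ?_).le
          rw [Real.dist_eq]
          exact (abs_sub_left_of_mem_uIcc hx).trans_lt hlt
      have h2 := norm_sub_norm_le ((t - s) • deriv (L.curve i) s) (L.curve i t - L.curve i s)
      rw [norm_sub_rev (_ • _), norm_smul, hv.2, Real.norm_eq_abs] at h2
      have h3 := mul_le_mul_of_nonneg_right (min_le_left (v i / 2) m) (abs_nonneg (t - s))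
      linarith
    · have h1 := hmin (s - ⌊s⌋, t - s) ⟨⟨⟨Int.fract_nonneg s, (Int.fract_lt_one s).le⟩,
        by rw [neg_div]; exact abs_le.1 hst⟩, hge⟩
      simp only [show s - ⌊s⌋ + (t - s) = t - ⌊s⌋ by ring, L.curve_fract] at h1
      have h3 := mul_le_mul_of_nonneg_right (min_le_right (v i / 2) m) (abs_nonneg (t - s))
      nlinarith [abs_nonneg (t - s)]
  have hfar : ∀ p : Fin n × Fin n, ∃ c > 0, p.1 ≠ p.2 →
      ∀ s t, c ≤ ‖L.curve p.1 t - L.curve p.2 s‖ := by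
    rintro ⟨i, j⟩
    by_cases hij : i = j
    · exact ⟨1, one_pos, fun h => absurd hij h⟩
    have hK := (L.isCompact_range_curve i).prod (L.isCompact_range_curve j)
    obtain ⟨m, hm, hmin⟩ := hK.exists_forall_le' (f := fun p : E3 × E3 => ‖p.1 - p.2‖) (a := 0)
      (by fun_prop) (by
        rintro ⟨_, _⟩ ⟨⟨s, rfl⟩, ⟨t, rfl⟩⟩
        exact norm_pos_iff.2 (sub_ne_zero.2 fun he => hij (L.embedded i j s t he).1))
    exact ⟨m, hm, fun _ s t => hmin (_, _) ⟨mem_range_self t, mem_range_self s⟩⟩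
  choose a ha0 ha using hnear
  choose b hb0 hb using hfar
  obtain ⟨c₁, hc₁, h₁⟩ := exists_pos_forall_le a ha0
  obtain ⟨c₂, hc₂, h₂⟩ := exists_pos_forall_le b hb0
  exact ⟨min c₁ c₂, lt_min hc₁ hc₂,
    fun i s t h => (mul_le_mul_of_nonneg_right ((min_le_left _ _).trans (h₁ i))
      (abs_nonneg _)).trans (ha i s t h),
    fun i j hij s t => ((min_le_right _ _).trans (h₂ (i, j))).trans (hb (i, j) hij s t)⟩

/-! ### Uniform estimates from the tube condition, and a converse -/

section Tube

variable {L : Link n} {v : Fin n → ℝ} {r : ℝ}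

/-- The tube condition at both ends of a short chord e bounds its normal parts by v²h²/(2r), so e is
close to both α T and β T'. As ‖T‖ = ‖T'‖ and β ≥ h/2, the tangents differ by at most 4v²h/r. Short
steps suffice by `norm_sub_le_of_local`. -/
theorem Tube.norm_deriv_sub_le (hT : L.Tube r) (hr : 0 < r) (hv : L.HasSpeed v) (i : Fin n)
    (s t : ℝ) : ‖deriv (L.curve i) t - deriv (L.curve i) s‖ ≤ 4 * v i ^ 2 / r * |t - s| := by
  obtain ⟨η, hη, hu⟩ := Metric.uniformContinuous_iff.1 (L.uniformContinuous_deriv_curve i)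
    (v i / 2) (half_pos (hv.1 i))
  have hv0 := hv.1 i
  have main : ∀ s h, 0 < h → h < η →
      ‖deriv (L.curve i) (s + h) - deriv (L.curve i) s‖ ≤ 4 * v i ^ 2 / r * h := by
    intro s h h0 hη'
    set T := deriv (L.curve i) s with hTdef
    set T' := deriv (L.curve i) (s + h) with hT'def
    set e := L.curve i (s + h) - L.curve i s with he
    have hTn : ‖T‖ = v i := hv.2 i s
    have hTn' : ‖T'‖ = v i := hv.2 i (s + h)
    have hen : ‖e‖ ≤ v i * h := by
      have := norm_sub_le_of_norm_deriv_le (L.differentiable_curve i) (fun x => (hv.2 i x).le)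
        s (s + h)
      rwa [add_sub_cancel_left, abs_of_pos h0] at this
    have hcl : ∀ u ∈ Icc s (s + h), ‖e - h • deriv (L.curve i) u‖ ≤ v i / 2 * h := by
      intro u hu'
      have := norm_sub_sub_smul_le (L.differentiable_curve i) (s := s) (t := s + h)
        (T := deriv (L.curve i) u) (C := v i / 2) fun x hx => by
          rw [uIcc_of_le (by linarith)] at hx
          rw [← dist_eq_norm]
          refine (hu ?_).le
          rw [Real.dist_eq]
          exact (abs_sub_le_iff.2 ⟨by linarith [hx.2, hu'.1], by linarith [hx.1, hu'.2]⟩).trans_lt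
            hη'
      rwa [add_sub_cancel_left, abs_of_pos h0] at this
    -- A chord within v h/2 of h S has component at least h/2 along S; this keeps α and β away from
    -- 0.
    have hproj : ∀ S : E3, ‖S‖ = v i → ‖e - h • S‖ ≤ v i / 2 * h →
        h / 2 ≤ inner ℝ e S / v i ^ 2 := by
      intro S hS hS'
      have h1 := real_inner_le_norm (h • S - e) S
      rw [norm_sub_rev, hS, inner_sub_left, real_inner_smul_left, real_inner_self_eq_norm_sq,
        hS] at h1
      rw [le_div_iff₀ (by positivity)]
      nlinarith
    have hperp : ∀ S : E3, ‖S‖ = v i → inner ℝ S (e - (inner ℝ e S / v i ^ 2) • S) = 0 := by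
      intro S hS
      rw [inner_sub_right, real_inner_smul_right, real_inner_self_eq_norm_sq, hS,
        div_mul_cancel₀ _ (by positivity), real_inner_comm, sub_self]
    have hnorm : ∀ w : E3, 2 * r * inner ℝ e w ≤ ‖e‖ ^ 2 * ‖w‖ → inner ℝ e w = ‖w‖ ^ 2 →
        ‖w‖ ≤ v i ^ 2 * h ^ 2 / (2 * r) := by
      intro w h1 h2
      rw [h2] at h1
      have h3 : ‖e‖ ^ 2 ≤ v i ^ 2 * h ^ 2 := by
        rw [← mul_pow]; exact pow_le_pow_left₀ (norm_nonneg _) hen 2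
      rw [le_div_iff₀ (by positivity)]
      rcases (norm_nonneg w).eq_or_lt with h4 | h4
      · rw [← h4, zero_mul]; positivity
      · refine le_of_mul_le_mul_right ?_ h4
        nlinarith
    have hself : ∀ S : E3, ‖S‖ = v i → inner ℝ e (e - (inner ℝ e S / v i ^ 2) • S) =
        ‖e - (inner ℝ e S / v i ^ 2) • S‖ ^ 2 := by
      intro S hS
      have := hperp S hS
      rw [← real_inner_self_eq_norm_sq]
      conv_rhs => rw [inner_sub_left, real_inner_smul_left, this, mul_zero, sub_zero]
    set α := inner ℝ e T / v i ^ 2 with hα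
    set β := inner ℝ e T' / v i ^ 2 with hβ
    have hβ0 : h / 2 ≤ β := hproj T' hTn' (hcl _ ⟨by linarith, le_rfl⟩)
    have hw : ‖e - α • T‖ ≤ v i ^ 2 * h ^ 2 / (2 * r) :=
      hnorm _ (hT i s i (s + h) _ (hperp T hTn)) (hself T hTn)
    have hw' : ‖e - β • T'‖ ≤ v i ^ 2 * h ^ 2 / (2 * r) := by
      refine hnorm _ ?_ (hself T' hTn')
      have := hT i (s + h) i s (-(e - β • T')) (by rw [inner_neg_right, hperp T' hTn', neg_zero])
      rwa [show L.curve i s - L.curve i (s + h) = -e by rw [he, neg_sub], inner_neg_neg, norm_neg,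
        norm_neg] at this
    have hdiff : ‖α • T - β • T'‖ ≤ v i ^ 2 * h ^ 2 / r := by
      have := norm_sub_le (e - β • T') (e - α • T)
      rw [show (e - β • T') - (e - α • T) = α • T - β • T' by abel] at this
      calc _ ≤ _ := this
        _ ≤ v i ^ 2 * h ^ 2 / (2 * r) + v i ^ 2 * h ^ 2 / (2 * r) := add_le_add hw' hw
        _ = _ := by field_simp; ring
    have hα0 : h / 2 ≤ α := hproj T hTn (hcl _ ⟨le_rfl, by linarith⟩)
    have hαβ : |β - α| * v i ≤ v i ^ 2 * h ^ 2 / r := by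
      have := abs_norm_sub_norm_le (α • T) (β • T')
      rw [norm_smul, norm_smul, hTn, hTn', Real.norm_of_nonneg (by linarith),
        Real.norm_of_nonneg (by linarith), ← sub_mul, abs_mul, abs_of_pos hv0, abs_sub_comm] at this
      exact this.trans hdiff
    have hfin : β * ‖T' - T‖ ≤ 2 * (v i ^ 2 * h ^ 2 / r) := by
      have h1 : β • (T' - T) = -(α • T - β • T') - (β - α) • T := by module
      have h2 := norm_sub_le (-(α • T - β • T')) ((β - α) • T)
      rw [← h1, norm_neg, norm_smul, norm_smul, hTn, Real.norm_of_nonneg (by linarith),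
        Real.norm_eq_abs] at h2
      linarith
    have h1 : h / 2 * ‖T' - T‖ ≤ h / 2 * (4 * v i ^ 2 / r * h) := by
      calc _ ≤ β * ‖T' - T‖ := mul_le_mul_of_nonneg_right hβ0 (norm_nonneg _)
        _ ≤ _ := hfin
        _ = _ := by ring
    exact le_of_mul_le_mul_left h1 (by linarith)
  refine norm_sub_le_of_local hη (fun s t hst => ?_) s t
  rcases lt_trichotomy s t with h | rfl | h
  · rw [abs_of_pos (sub_pos.2 h)] at hst ⊢
    have := main s (t - s) (sub_pos.2 h) hst
    rwa [add_sub_cancel] at this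
  · simp
  · rw [abs_sub_comm, abs_of_pos (sub_pos.2 h)] at hst ⊢
    have := main t (s - t) (sub_pos.2 h) hst
    rwa [add_sub_cancel, norm_sub_rev] at this

/-- At a local minimum the chord is itself a normal vector; put w equal to it. -/
theorem Tube.two_mul_le_of_isLocalMin (hT : L.Tube r) {i j : Fin n} {s t : ℝ}
    (hne : L.curve j t ≠ L.curve i s)
    (hmin : IsLocalMin (fun u => ‖L.curve j t - L.curve i u‖ ^ 2) s) :
    2 * r ≤ ‖L.curve j t - L.curve i s‖ := by
  have h1 := hT i s j t _ (L.inner_deriv_eq_zero_of_isLocalMin hmin)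
  rw [real_inner_self_eq_norm_sq] at h1
  have h2 : 0 < ‖L.curve j t - L.curve i s‖ := norm_pos_iff.2 (sub_ne_zero.2 hne)
  refine le_of_mul_le_mul_right ?_ (pow_pos h2 2)
  linarith

/-- The constant depends on r alone, so it survives limits. Short arcs are handled by the tangent
estimate; otherwise distances are minimized, an interior minimum being at least 2r. -/
theorem Tube.biLip (hT : L.Tube r) (hr : 0 < r) (hv : L.HasSpeed v) :
    BiLip (r / 8) L.curve := by
  constructor
  · intro i
    have hv0 := hv.1 i
    have hK : 0 < 4 * v i ^ 2 / r := by positivity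
    have happrox : ∀ s t, ‖L.curve i t - L.curve i s - (t - s) • deriv (L.curve i) s‖ ≤
        4 * v i ^ 2 / r * |t - s| * |t - s| := fun s t =>
      norm_sub_sub_smul_le (L.differentiable_curve i) fun x hx =>
        (hT.norm_deriv_sub_le hr hv i s x).trans
          (mul_le_mul_of_nonneg_left (abs_sub_left_of_mem_uIcc hx) hK.le)
    -- A closed curve returns after parameter length one, so the quadratic estimate there reads v ≤
    -- 4v²/r.
    have hvr : r / 4 ≤ v i := by
      have h1 := happrox 0 1
      have h2 := L.periodic i 0
      rw [zero_add] at h2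
      rw [h2, sub_self, zero_sub, norm_neg, sub_zero, one_smul, hv.2, abs_one, mul_one, mul_one,
        le_div_iff₀ hr] at h1
      nlinarith
    -- Up to r/(8v) the tangent varies by at most v/2; at h₀ itself the chord is then at least r/16.
    set h₀ := min (r / (8 * v i)) (1 / 2) with hh₀
    have hh₀pos : 0 < h₀ := lt_min (by positivity) (by norm_num)
    have hh₀r : r / 16 ≤ v i * h₀ / 2 := by
      rw [hh₀]
      rcases min_choice (r / (8 * v i)) (1 / 2) with h | h <;> rw [h]
      · rw [show v i * (r / (8 * v i)) / 2 = r / 16 by field_simp; norm_num]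
      · linarith
    have hnear : ∀ s t, |t - s| ≤ h₀ → v i * |t - s| / 2 ≤ ‖L.curve i t - L.curve i s‖ := by
      intro s t hst
      have h1 := happrox s t
      have h2 := norm_sub_norm_le ((t - s) • deriv (L.curve i) s) (L.curve i t - L.curve i s)
      rw [norm_sub_rev (_ • _), norm_smul, hv.2, Real.norm_eq_abs] at h2
      have h3 : 4 * v i ^ 2 / r * |t - s| ≤ v i / 2 := by
        calc _ ≤ 4 * v i ^ 2 / r * (r / (8 * v i)) :=
              mul_le_mul_of_nonneg_left (hst.trans (min_le_left _ _)) hK.le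
          _ = _ := by field_simp; norm_num
      have h4 := mul_le_mul_of_nonneg_right h3 (abs_nonneg (t - s))
      linarith
    have hfar : ∀ s t, s + h₀ ≤ t → t ≤ s + 1 - h₀ → r / 16 ≤ ‖L.curve i t - L.curve i s‖ := by
      intro s t ht1 ht2
      obtain ⟨u, hu, humin⟩ := isCompact_Icc.exists_isMinOn
        (s := Icc (s + h₀) (s + 1 - h₀)) ⟨t, ht1, ht2⟩
        (f := fun u => ‖L.curve i s - L.curve i u‖ ^ 2) (by
          have := L.continuous_curve i
          fun_prop)
      have hle : ‖L.curve i s - L.curve i u‖ ≤ ‖L.curve i t - L.curve i s‖ := by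
        rw [norm_sub_rev (L.curve i t)]
        exact (pow_le_pow_iff_left₀ (norm_nonneg _) (norm_nonneg _) two_ne_zero).1
          (humin ⟨ht1, ht2⟩)
      refine le_trans ?_ hle
      rcases hu.1.eq_or_lt with h1 | h1
      · have := hnear s u (by rw [← h1, add_sub_cancel_left, abs_of_pos hh₀pos])
        rw [← h1, add_sub_cancel_left, abs_of_pos hh₀pos, norm_sub_rev, h1] at this
        linarith
      rcases hu.2.eq_or_lt with h2 | h2
      · have h3 : |u - 1 - s| = h₀ := by
          rw [h2, show s + 1 - h₀ - 1 - s = -h₀ by ring, abs_neg, abs_of_pos hh₀pos]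
        have := hnear s (u - 1) h3.le
        rw [h3, (L.periodic i).sub_eq, norm_sub_rev] at this
        linarith
      · have := hT.two_mul_le_of_isLocalMin (i := i) (j := i) (s := u) (t := s) (fun he => by
            obtain ⟨-, k, hk⟩ := L.embedded _ _ _ _ he
            have h3 : (0 : ℝ) < k := by linarith
            have h4 : (k : ℝ) < 1 := by linarith
            have h3 : 0 < k := by exact_mod_cast h3
            have h4 : k < 1 := by exact_mod_cast h4
            omega) (humin.isLocalMin (Icc_mem_nhds h1 h2))
        linarith
    intro s t hst
    rcases le_or_gt |t - s| h₀ with h | h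
    · refine le_trans ?_ (hnear s t h)
      nlinarith [abs_nonneg (t - s)]
    · have hb : r / 16 ≤ ‖L.curve i t - L.curve i s‖ := by
        have hh₀' : h₀ ≤ 1 / 2 := min_le_right _ _
        rcases le_total 0 (t - s) with h1 | h1
        · rw [abs_of_nonneg h1] at h hst
          exact hfar s t (by linarith) (by linarith)
        · rw [abs_of_nonpos h1] at h hst
          rw [← L.periodic i t]
          exact hfar s (t + 1) (by linarith) (by linarith)
      refine le_trans ?_ hb
      nlinarith [abs_nonneg (t - s)]
  · intro i j hij s t
    obtain ⟨_, ⟨u, rfl⟩, humin⟩ := (L.isCompact_range_curve j).exists_isMinOn ⟨_, s, rfl⟩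
      (f := fun x => ‖L.curve i t - x‖ ^ 2) (by fun_prop)
    have hle : ‖L.curve i t - L.curve j u‖ ≤ ‖L.curve i t - L.curve j s‖ :=
      (pow_le_pow_iff_left₀ (norm_nonneg _) (norm_nonneg _) two_ne_zero).1
        (humin (mem_range_self s))
    have := hT.two_mul_le_of_isLocalMin (i := j) (j := i) (s := u) (t := t)
      (fun he => hij (L.embedded _ _ _ _ he).1)
      (Eventually.of_forall fun x => humin (mem_range_self x))
    linarith

/-- A link with Lipschitz tangents has positive reach. -/
theorem exists_tube_of_lipschitz {c K : ℝ} (hc : 0 < c) (hL : BiLip c L.curve) (hK : 0 < K)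
    (hlip : ∀ i s t, ‖deriv (L.curve i) t - deriv (L.curve i) s‖ ≤ K * |t - s|) :
    ∃ r > 0, L.Tube r := by
  -- On one component the chord leaves the tangent line by at most K|u - s|² and has length at least
  -- c|u - s|, whence c²/(2K). Distinct components are c apart, so c/2 works by Cauchy–Schwarz.
  refine ⟨min (c ^ 2 / (2 * K)) (c / 2), lt_min (by positivity) (by positivity), ?_⟩
  intro i s j t w hw
  set r := min (c ^ 2 / (2 * K)) (c / 2) with hr
  have hr0 : 0 < r := lt_min (by positivity) (by positivity)
  by_cases hij : i = j
  · subst hij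
    obtain ⟨k, hk⟩ : ∃ k : ℤ, |t + k - s| ≤ 1 / 2 := ⟨-round (t - s), by
      have := abs_sub_round (t - s)
      push_cast
      rwa [show t + -(round (t - s) : ℝ) - s = t - s - round (t - s) by ring]⟩
    rw [← L.periodic_int i t k]
    set u := t + k
    have h1 := norm_sub_sub_smul_le (L.differentiable_curve i) (s := s) (t := u)
      (T := deriv (L.curve i) s) (C := K * |u - s|) fun x hx =>
        (hlip i s x).trans (mul_le_mul_of_nonneg_left (abs_sub_left_of_mem_uIcc hx) hK.le)
    have h2 : (inner ℝ (L.curve i u - L.curve i s) w : ℝ) =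
        inner ℝ (L.curve i u - L.curve i s - (u - s) • deriv (L.curve i) s) w := by
      rw [inner_sub_left _ ((u - s) • _), real_inner_smul_left, hw, mul_zero, sub_zero]
    have h3 := real_inner_le_norm
      (L.curve i u - L.curve i s - (u - s) • deriv (L.curve i) s) w
    rw [← h2] at h3
    have h4 := pow_le_pow_left₀ (by positivity) (hL.near i s u hk) 2
    have h5 : 2 * r * K ≤ c ^ 2 := by
      have := min_le_left (c ^ 2 / (2 * K)) (c / 2)
      rw [← hr, le_div_iff₀ (by positivity)] at this
      linarith
    have h6 : 2 * r * (K * |u - s| * |u - s|) ≤ ‖L.curve i u - L.curve i s‖ ^ 2 := by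
      refine le_trans ?_ h4
      rw [mul_pow]
      nlinarith [sq_nonneg |u - s|]
    calc _ ≤ 2 * r * (K * |u - s| * |u - s| * ‖w‖) := by
          refine mul_le_mul_of_nonneg_left (h3.trans ?_) (by positivity)
          exact mul_le_mul_of_nonneg_right h1 (norm_nonneg _)
      _ = 2 * r * (K * |u - s| * |u - s|) * ‖w‖ := by ring
      _ ≤ _ := mul_le_mul_of_nonneg_right h6 (norm_nonneg _)
  · have h1 := hL.far j i (Ne.symm hij) s t
    have h2 := real_inner_le_norm (L.curve j t - L.curve i s) w
    have h3 : 2 * r ≤ c := by linarith [min_le_right (c ^ 2 / (2 * K)) (c / 2)]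
    calc _ ≤ 2 * r * (‖L.curve j t - L.curve i s‖ * ‖w‖) :=
          mul_le_mul_of_nonneg_left h2 (by positivity)
      _ ≤ ‖L.curve j t - L.curve i s‖ * (‖L.curve j t - L.curve i s‖ * ‖w‖) :=
          mul_le_mul_of_nonneg_right (h3.trans h1) (by positivity)
      _ = _ := by ring

end Tube

end Link

/-! ### Fixed points, scaling and smoothing: thick links exist -/

theorem integral_isometry (g : E3 ≃ᵢ E3) {f : ℝ → E3} (hf : Continuous f) (a b : ℝ) :
    ∫ u in a..b, g (f u) = linearPart g (∫ u in a..b, f u) + (b - a) • g 0 := by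
  have h1 : ∀ u, g (f u) = linearPart g (f u) + g 0 := fun u => isometry_apply_eq g _
  have h2 : Continuous fun u => linearPart g (f u) := (linearPart g).continuous.comp hf
  simp only [h1]
  rw [intervalIntegral.integral_add (h2.intervalIntegrable _ _)
    (continuous_const.intervalIntegrable _ _), intervalIntegral.integral_const]
  congr 1
  exact (linearPart g).toContinuousLinearEquiv.toContinuousLinearMap.intervalIntegral_comp_comm
    (hf.intervalIntegrable _ _)

namespace Link

variable {n : ℕ} {o : Prop} {G : Subgroup (E3 ≃ᵢ E3)}

/-- Windows symmetric about s go to windows symmetric about ε s + c, even under reflection; this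
makes averaging equivariant. -/
theorem IsSign.integral_comp {ε : ℝ} (hε : IsSign o ε) (f : ℝ → E3) (c s δ : ℝ) :
    ∫ u in (s - δ)..(s + δ), f (ε * u + c) = ∫ u in (ε * s + c - δ)..(ε * s + c + δ), f u := by
  rcases hε with rfl | ⟨rfl, -⟩
  · simp only [one_mul]
    rw [intervalIntegral.integral_comp_add_right]
    congr 1 <;> ring
  · have h : ∀ u : ℝ, -1 * u + c = c - u := fun u => by ring
    simp only [h]
    rw [intervalIntegral.integral_comp_sub_left]
    congr 1 <;> ring

/-- The centre of mass of a component. -/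
noncomputable def center (L : Link n) (i : Fin n) : E3 :=
  ∫ u in (0 : ℝ)..1, L.curve i u

theorem center_eq (L : Link n) (i : Fin n) (s : ℝ) :
    L.center i = ∫ u in (s - 1 / 2)..(s + 1 / 2), L.curve i u := by
  have := (L.periodic i).intervalIntegral_add_eq (s - 1 / 2) 0
  rw [zero_add] at this
  rw [Link.center, ← this]
  congr 1; ring

theorem isometry_center (L : Link n) {g : E3 ≃ᵢ E3} {i j : Fin n} {ε c : ℝ} (hε : IsSign o ε)
    (h : ∀ s, g (L.curve i s) = L.curve j (ε * s + c)) : g (L.center i) = L.center j := by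
  rw [isometry_apply_eq, L.center_eq i 0, L.center_eq j (ε * 0 + c), ← hε.integral_comp]
  simp only [← h]
  rw [integral_isometry g (L.continuous_curve i)]
  norm_num

/-- If two components had the same image component, a point of one would share its image with a
point of the other, against injectivity of g. -/
theorem exists_perm_of_action {M : Link n}
    (h : ∀ g ∈ G, ∀ i, ∃ j ε c, IsSign o ε ∧ ∀ s, g (M.curve i s) = M.curve j (ε * s + c))
    {g : E3 ≃ᵢ E3} (hg : g ∈ G) : ∃ σ : Equiv.Perm (Fin n), ∀ i, ∃ ε c, IsSign o ε ∧
      ∀ s, g (M.curve i s) = M.curve (σ i) (ε * s + c) := by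
  choose σ ε c hε hσ using h g hg
  have hinj : Function.Injective σ := by
    intro i j hij
    have h1 := hσ i 0
    have h2 := hσ j (ε j * (c i - c j))
    rw [← mul_assoc, (hε j).mul_self, one_mul, sub_add_cancel, ← hij] at h2
    rw [mul_zero, zero_add, ← h2] at h1
    exact (M.embedded _ _ _ _ (g.injective h1)).1
  exact ⟨Equiv.ofBijective σ (Finite.injective_iff_bijective.1 hinj),
    fun i => ⟨ε i, c i, hε i, hσ i⟩⟩

theorem isometry_average {ι : Type*} {S : Finset ι} (hS : S.Nonempty) (g : E3 ≃ᵢ E3)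
    (x : ι → E3) : g ((S.card : ℝ)⁻¹ • ∑ i ∈ S, x i) = (S.card : ℝ)⁻¹ • ∑ i ∈ S, g (x i) := by
  have hc : (S.card : ℝ) ≠ 0 := Nat.cast_ne_zero.2 hS.card_pos.ne'
  simp only [fun i => isometry_apply_eq g (x i)]
  rw [isometry_apply_eq, map_smul, map_sum, Finset.sum_add_distrib, smul_add, Finset.sum_const,
    ← Nat.cast_smul_eq_nsmul ℝ, smul_smul, inv_mul_cancel₀ hc, one_smul]

/-- A group that preserves a link has a fixed point. -/
theorem exists_fixedPoint {M : Link n} (hn : 1 ≤ n)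
    (h : ∀ g ∈ G, ∀ i, ∃ j ε c, IsSign o ε ∧ ∀ s, g (M.curve i s) = M.curve j (ε * s + c)) :
    ∃ x₀ : E3, ∀ g ∈ G, g x₀ = x₀ := by
  have : (Finset.univ : Finset (Fin n)).Nonempty := ⟨⟨0, hn⟩, Finset.mem_univ _⟩
  refine ⟨((Finset.univ : Finset (Fin n)).card : ℝ)⁻¹ • ∑ i, M.center i, fun g hg => ?_⟩
  obtain ⟨σ, hσ⟩ := exists_perm_of_action h hg
  rw [isometry_average this]
  congr 1
  rw [← Equiv.sum_comp σ M.center]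
  refine Finset.sum_congr rfl fun i _ => ?_
  obtain ⟨ε, c, hε, hc⟩ := hσ i
  exact M.isometry_center hε hc

theorem isometry_homothety {g : E3 ≃ᵢ E3} {x₀ : E3} (hx₀ : g x₀ = x₀) (μ : ℝ) (x : E3) :
    g (x₀ + μ • (x - x₀)) = x₀ + μ • (g x - x₀) := by
  have := isometry_combination g μ x₀ x
  rw [hx₀] at this
  rw [show x₀ + μ • (x - x₀) = (1 - μ) • x₀ + μ • x by module, this]
  module

/-- Scaling about a fixed point of the group. -/
theorem exists_isotopicThrough_homothety {M : Link n}
    (h : ∀ g ∈ G, ∀ i, ∃ j ε c, IsSign o ε ∧ ∀ s, g (M.curve i s) = M.curve j (ε * s + c))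
    {x₀ : E3} (hx₀ : ∀ g ∈ G, g x₀ = x₀) {r μ : ℝ} (hμ : 0 < μ) (hM : M.Tube r) :
    ∃ N : Link n, IsotopicThrough (IsInv o G) M N ∧ N.Tube (μ * r) := by
  have hC : ∀ i, ContDiff ℝ 1 fun s => x₀ + μ • (M.curve i s - x₀) := fun i =>
    contDiff_const.add (((M.contDiff i).sub contDiff_const).const_smul μ)
  have hd : ∀ i s, deriv (fun s => x₀ + μ • (M.curve i s - x₀)) s = μ • deriv (M.curve i) s :=
    fun i s => ((((M.differentiable_curve i s).hasDerivAt.sub_const x₀).const_smul μ).const_add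
      x₀).deriv
  have hpos : ∀ τ ∈ Icc (0 : ℝ) 1, 0 < (1 - τ) + τ * μ := by
    intro τ hτ
    rcases hτ.2.eq_or_lt with rfl | h1
    · simpa using hμ
    · nlinarith [mul_nonneg hτ.1 hμ.le]
  obtain ⟨N, hN, hiso⟩ := M.exists_isotopicThrough_segment (o := o) (G := G)
    (fun i s => x₀ + μ • (M.curve i s - x₀)) (fun i s => by simp only [M.periodic i s]) hC
    (fun τ hτ i s => by
      rw [hd, smul_smul, ← add_smul]
      exact smul_ne_zero (hpos τ hτ).ne' (M.regular i s))
    (fun τ hτ i j s t hst => by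
      refine M.embedded i j s t ?_
      have h1 : ∀ x : E3, (1 - τ) • x + τ • (x₀ + μ • (x - x₀)) =
          x₀ + ((1 - τ) + τ * μ) • (x - x₀) := fun x => by module
      rw [h1, h1] at hst
      exact sub_left_injective (smul_right_injective _ (hpos τ hτ).ne' (add_right_injective _ hst)))
    (fun g hg i => by
      obtain ⟨j, ε, c, hε, hj⟩ := h g hg i
      exact ⟨j, ε, c, hε, hj, fun s => by rw [isometry_homothety (hx₀ g hg), hj]⟩)
  refine ⟨N, hiso, fun i s j t w hw => ?_⟩
  rw [hN] at hw ⊢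
  simp only [hd] at hw
  rw [real_inner_smul_left, mul_eq_zero, or_iff_right hμ.ne'] at hw
  have h1 := hM i s j t w hw
  rw [show x₀ + μ • (M.curve j t - x₀) - (x₀ + μ • (M.curve i s - x₀)) =
    μ • (M.curve j t - M.curve i s) by module, real_inner_smul_left, norm_smul,
    Real.norm_of_nonneg hμ.le]
  calc _ = μ ^ 2 * (2 * r * inner ℝ (M.curve j t - M.curve i s) w) := by ring
    _ ≤ μ ^ 2 * (‖M.curve j t - M.curve i s‖ ^ 2 * ‖w‖) :=
      mul_le_mul_of_nonneg_left h1 (by positivity)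
    _ = _ := by ring

/-- The average of a family of curves over parameter intervals of radius `δ`. -/
noncomputable def boxAverage (δ : ℝ) (γ : Fin n → ℝ → E3) (i : Fin n) (s : ℝ) : E3 :=
  (2 * δ)⁻¹ • ∫ u in (s - δ)..(s + δ), γ i u

theorem hasDerivAt_boxAverage (δ : ℝ) {γ : Fin n → ℝ → E3} {i : Fin n} (hγ : Continuous (γ i))
    (s : ℝ) :
    HasDerivAt (boxAverage δ γ i) ((2 * δ)⁻¹ • (γ i (s + δ) - γ i (s - δ))) s := by
  have h1 : boxAverage δ γ i = fun s =>
      (2 * δ)⁻¹ • ((∫ u in (0 : ℝ)..(s + δ), γ i u) - ∫ u in (0 : ℝ)..(s - δ), γ i u) := by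
    funext s
    rw [boxAverage, intervalIntegral.integral_interval_sub_left
      (hγ.intervalIntegrable _ _) (hγ.intervalIntegrable _ _)]
  have h2 : ∀ s, HasDerivAt (fun s => ∫ u in (0 : ℝ)..s, γ i u) (γ i s) s := fun s =>
    (hγ.integral_hasStrictDerivAt 0 s).hasDerivAt
  rw [h1]
  exact (((h2 (s + δ)).comp_add_const s δ).sub ((h2 (s - δ)).comp_sub_const s δ)).const_smul
    (2 * δ)⁻¹

/-- Every invariant link is isotopic to an invariant link with thickness at least one. -/
theorem exists_isotopicThrough_tube (hn : 1 ≤ n) {L : Link n} (hL : IsInv o G L) :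
    ∃ N : Link n, IsotopicThrough (IsInv o G) L N ∧ N.Tube (1 / 2) := by
  obtain ⟨M, v, hLM, -, hv, -⟩ := hL.exists_hasSpeed
  have hact := hLM.right.exists_action hv
  obtain ⟨x₀, hx₀⟩ := exists_fixedPoint hn hact
  obtain ⟨c, hc, hbi⟩ := hv.exists_biLip
  obtain ⟨V, hV⟩ := (Set.finite_range v).bddAbove
  replace hV : ∀ i, v i ≤ V := fun i => hV (mem_range_self i)
  have hV0 : 0 < V := (hv.1 ⟨0, hn⟩).trans_le (hV _)
  have hunif : ∀ i, ∃ η > 0, ∀ a b, dist a b < η →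
      dist (deriv (M.curve i) a) (deriv (M.curve i) b) < c / 2 := fun i => by
    obtain ⟨η, hη, h⟩ := Metric.uniformContinuous_iff.1 (M.uniformContinuous_deriv_curve i)
      (c / 2) (half_pos hc)
    exact ⟨η, hη, fun a b => @h a b⟩
  choose η hη hηc using hunif
  obtain ⟨η₀, hη₀, hle⟩ := exists_pos_forall_le η hη
  -- The first bound keeps derivatives within c/2 of their averages, the second keeps positions
  -- within V δ ≤ c/4.
  set δ := min (η₀ / 2) (c / (4 * V)) with hδ
  have hδ0 : 0 < δ := lt_min (by positivity) (by positivity)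
  have hδη : δ < η₀ := (min_le_left _ _).trans_lt (by linarith)
  have hδV : V * δ ≤ c / 4 := by
    calc V * δ ≤ V * (c / (4 * V)) := mul_le_mul_of_nonneg_left (min_le_right _ _) hV0.le
      _ = c / 4 := by field_simp
  have hlip : ∀ i s t, ‖M.curve i t - M.curve i s‖ ≤ V * |t - s| := fun i =>
    norm_sub_le_of_norm_deriv_le (M.differentiable_curve i) fun x => (hv.2 i x).trans_le (hV i)
  have hder : ∀ i s, deriv (boxAverage δ M.curve i) s =
      (2 * δ)⁻¹ • (M.curve i (s + δ) - M.curve i (s - δ)) := fun i s =>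
    (hasDerivAt_boxAverage δ (M.continuous_curve i) s).deriv
  have hclose : C1Close (c / 2) M.curve (boxAverage δ M.curve) := by
    constructor
    · intro i s
      have h1 : M.curve i s - boxAverage δ M.curve i s =
          -((2 * δ)⁻¹ • ∫ u in (s - δ)..(s + δ), (M.curve i u - M.curve i s)) := by
        rw [intervalIntegral.integral_sub ((M.continuous_curve i).intervalIntegrable _ _)
          (continuous_const.intervalIntegrable _ _), intervalIntegral.integral_const, boxAverage,
          show s + δ - (s - δ) = 2 * δ by ring, smul_sub, smul_smul,
          inv_mul_cancel₀ (by positivity), one_smul, neg_sub]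
      have h2 : ‖∫ u in (s - δ)..(s + δ), (M.curve i u - M.curve i s)‖ ≤
          V * δ * |s + δ - (s - δ)| := by
        refine intervalIntegral.norm_integral_le_of_norm_le_const fun u hu => ?_
        rw [uIoc_of_le (by linarith)] at hu
        refine (hlip i s u).trans (mul_le_mul_of_nonneg_left ?_ hV0.le)
        exact abs_sub_le_iff.2 ⟨by linarith [hu.2], by linarith [hu.1]⟩
      rw [show s + δ - (s - δ) = 2 * δ by ring, abs_of_pos (by positivity)] at h2
      rw [h1, norm_neg, norm_smul, norm_inv, Real.norm_of_nonneg (by positivity),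
        inv_mul_le_iff₀ (by positivity)]
      nlinarith
    · intro i s
      have h1 := norm_sub_sub_smul_le (M.differentiable_curve i) (s := s - δ) (t := s + δ)
        (T := deriv (M.curve i) s) (C := c / 2) fun x hx => by
          rw [uIcc_of_le (by linarith)] at hx
          rw [← dist_eq_norm]
          refine (hηc i _ _ ?_).le
          rw [Real.dist_eq]
          exact (abs_sub_le_iff.2 ⟨by linarith [hx.2], by linarith [hx.1]⟩).trans_lt
            (hδη.trans_le (hle i))
      rw [show s + δ - (s - δ) = 2 * δ by ring, abs_of_pos (by positivity)] at h1
      rw [hder, norm_sub_rev, show (2 * δ)⁻¹ • (M.curve i (s + δ) - M.curve i (s - δ)) -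
        deriv (M.curve i) s = (2 * δ)⁻¹ • (M.curve i (s + δ) - M.curve i (s - δ) -
          (2 * δ) • deriv (M.curve i) s) by
            rw [smul_sub _ _ ((2 * δ) • _), smul_smul, inv_mul_cancel₀ (by positivity), one_smul],
        norm_smul, norm_inv, Real.norm_of_nonneg (by positivity), inv_mul_le_iff₀ (by positivity)]
      linarith
  have hactN : ∀ g ∈ G, ∀ i, ∃ j ε c, IsSign o ε ∧
      (∀ s, g (M.curve i s) = M.curve j (ε * s + c)) ∧
      ∀ s, g (boxAverage δ M.curve i s) = boxAverage δ M.curve j (ε * s + c) := by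
    intro g hg i
    obtain ⟨j, ε, c, hε, hj⟩ := hact g hg i
    refine ⟨j, ε, c, hε, hj, fun s => ?_⟩
    rw [boxAverage, boxAverage, ← hε.integral_comp]
    simp only [← hj]
    rw [integral_isometry g (M.continuous_curve i), isometry_apply_eq, map_smul, smul_add,
      smul_smul, show s + δ - (s - δ) = 2 * δ by ring, inv_mul_cancel₀ (by positivity), one_smul]
  obtain ⟨N, hN, hMN, hNbi⟩ := M.exists_isotopicThrough_of_close (boxAverage δ M.curve)
    (fun i s => by
      rw [boxAverage, boxAverage]
      congr 1
      have := intervalIntegral.integral_comp_add_right (M.curve i) (a := s - δ) (b := s + δ) 1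
      rw [show s + 1 - δ = s - δ + 1 by ring, show s + 1 + δ = s + δ + 1 by ring, ← this]
      exact intervalIntegral.integral_congr fun u _ => M.periodic i u)
    (fun i => by
      refine contDiff_one_iff_deriv.2
        ⟨fun s => (hasDerivAt_boxAverage δ (M.continuous_curve i) s).differentiableAt, ?_⟩
      have := M.continuous_curve i
      rw [show deriv (boxAverage δ M.curve i) = _ from funext (hder i)]
      fun_prop)
    hbi hclose (half_lt_self hc) hactN
  -- The derivative of the average is a difference quotient of V-Lipschitz curves over length 2δ,
  -- hence V/δ-Lipschitz.
  obtain ⟨r, hr, hT⟩ := exists_tube_of_lipschitz (L := N) (K := V / δ) (c := c - c / 2)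
    (by linarith) hNbi (by positivity) (fun i s t => by
      rw [hN, hder, hder, ← smul_sub, norm_smul, norm_inv, Real.norm_of_nonneg (by positivity),
        inv_mul_le_iff₀ (by positivity)]
      have h1 := hlip i (s + δ) (t + δ)
      have h2 := hlip i (s - δ) (t - δ)
      rw [add_sub_add_right_eq_sub] at h1
      rw [sub_sub_sub_cancel_right] at h2
      have h3 := norm_sub_le (M.curve i (t + δ) - M.curve i (s + δ))
        (M.curve i (t - δ) - M.curve i (s - δ))
      rw [sub_sub_sub_comm]
      calc _ ≤ _ := h3
        _ ≤ V * |t - s| + V * |t - s| := add_le_add h1 h2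
        _ = _ := by field_simp; ring)
  obtain ⟨N', hNN', hT'⟩ := exists_isotopicThrough_homothety (o := o) (G := G) (M := N)
    (fun g hg i => by
      obtain ⟨j, ε, c, hε, -, hj⟩ := hactN g hg i
      exact ⟨j, ε, c, hε, by rw [hN]; exact hj⟩) hx₀ (r := r) (μ := 1 / (2 * r)) (by positivity) hT
  refine ⟨N', (hLM.trans hMN).trans hNN', ?_⟩
  rwa [show 1 / (2 * r) * r = 1 / 2 by field_simp] at hT'

end Link

/-! ### Clusters of components and confinement to a ball -/

namespace Link

variable {n : ℕ} {o : Prop} {G : Subgroup (E3 ≃ᵢ E3)}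

theorem norm_sub_average_le {ι : Type*} {S : Finset ι} (hS : S.Nonempty) {y : ι → E3} {x : E3}
    {B : ℝ} (h : ∀ i ∈ S, ‖x - y i‖ ≤ B) : ‖x - (S.card : ℝ)⁻¹ • ∑ i ∈ S, y i‖ ≤ B := by
  have hc : (0 : ℝ) < S.card := Nat.cast_pos.2 hS.card_pos
  have h1 : x - (S.card : ℝ)⁻¹ • ∑ i ∈ S, y i = (S.card : ℝ)⁻¹ • ∑ i ∈ S, (x - y i) := by
    rw [Finset.sum_sub_distrib, Finset.sum_const, smul_sub, ← Nat.cast_smul_eq_nsmul ℝ, smul_smul,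
      inv_mul_cancel₀ hc.ne', one_smul]
  rw [h1, norm_smul, norm_inv, Real.norm_of_nonneg hc.le, inv_mul_le_iff₀ hc]
  refine (norm_sum_le _ _).trans ((Finset.sum_le_sum h).trans ?_)
  rw [Finset.sum_const, nsmul_eq_mul]

theorem norm_sub_center_le (M : Link n) {i : Fin n} {x : E3} {B : ℝ}
    (h : ∀ s, ‖x - M.curve i s‖ ≤ B) : ‖x - M.center i‖ ≤ B := by
  have h1 : x - M.center i = ∫ u in (0 : ℝ)..1, (x - M.curve i u) := by
    rw [intervalIntegral.integral_sub (continuous_const.intervalIntegrable _ _)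
      ((M.continuous_curve i).intervalIntegrable _ _), intervalIntegral.integral_const, sub_zero,
      one_smul, Link.center]
  rw [h1]
  have := intervalIntegral.norm_integral_le_of_norm_le_const (a := (0 : ℝ)) (b := 1)
    (f := fun u => x - M.curve i u) fun u _ => h u
  simpa using this

theorem HasSpeed.norm_sub_le {M : Link n} {v : Fin n → ℝ} (hv : M.HasSpeed v) (i : Fin n)
    (s t : ℝ) : ‖M.curve i s - M.curve i t‖ ≤ v i := by
  have h1 := norm_sub_le_of_norm_deriv_le (M.differentiable_curve i) (fun x => (hv.2 i x).le)
    t (s + (-round (s - t) : ℤ))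
  rw [M.periodic_int] at h1
  have h2 := abs_sub_round (s - t)
  push_cast at h1
  rw [show s + -(round (s - t) : ℝ) - t = s - t - round (s - t) by ring] at h1
  have h3 := hv.1 i
  nlinarith

/-- Two components are adjacent if they come close to each other. -/
def nearGraph (M : Link n) : SimpleGraph (Fin n) where
  Adj i j := i ≠ j ∧ ∃ s t, ‖M.curve i s - M.curve j t‖ ≤ 4
  symm := ⟨fun i j ⟨h, s, t, hst⟩ => ⟨h.symm, t, s, by rwa [norm_sub_rev]⟩⟩
  loopless := ⟨fun i h => h.1 rfl⟩

/-- Each edge costs at most 4 for the gap and Λ for crossing a component. -/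
theorem norm_sub_le_of_walk {M : Link n} {Λ : ℝ}
    (hΛ : ∀ i s t, ‖M.curve i s - M.curve i t‖ ≤ Λ) {i j : Fin n} (p : M.nearGraph.Walk i j)
    (s t : ℝ) : ‖M.curve i s - M.curve j t‖ ≤ Λ + p.length * (4 + Λ) := by
  induction p generalizing s with
  | nil => simpa using hΛ _ s t
  | @cons i k j h p ih =>
    obtain ⟨s', t', hst⟩ : ∃ s t, ‖M.curve i s - M.curve k t‖ ≤ 4 := h.2
    have h1 := hΛ i s s'
    have h2 := ih t'
    have h3 := norm_add₃_le (a := M.curve i s - M.curve i s') (b := M.curve i s' - M.curve k t')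
      (c := M.curve k t' - M.curve j t)
    rw [sub_add_sub_cancel, sub_add_sub_cancel] at h3
    rw [SimpleGraph.Walk.length_cons]
    push_cast
    linarith

theorem norm_sub_le_of_reachable {M : Link n} {Λ : ℝ} (hΛ0 : 0 ≤ Λ)
    (hΛ : ∀ i s t, ‖M.curve i s - M.curve i t‖ ≤ Λ) {i j : Fin n} (h : M.nearGraph.Reachable i j)
    (s t : ℝ) : ‖M.curve i s - M.curve j t‖ ≤ Λ + n * (4 + Λ) := by
  classical
  obtain ⟨p, hp⟩ := h.exists_isPath
  refine (norm_sub_le_of_walk hΛ p s t).trans ?_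
  have h1 : (p.length : ℝ) ≤ n := by
    have := hp.length_lt
    rw [Fintype.card_fin] at this
    exact_mod_cast this.le
  nlinarith

open Classical in
/-- The components in the cluster of a given one. -/
noncomputable def cluster (M : Link n) (i : Fin n) : Finset (Fin n) :=
  Finset.univ.filter fun j => M.nearGraph.Reachable i j

theorem mem_cluster {M : Link n} {i j : Fin n} :
    j ∈ M.cluster i ↔ M.nearGraph.Reachable i j := by
  classical
  simp [cluster]

theorem cluster_nonempty (M : Link n) (i : Fin n) : (M.cluster i).Nonempty :=
  ⟨i, mem_cluster.2 (SimpleGraph.Reachable.refl i)⟩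

theorem cluster_eq {M : Link n} {i j : Fin n} (h : M.nearGraph.Reachable i j) :
    M.cluster i = M.cluster j := by
  ext k
  rw [mem_cluster, mem_cluster]
  exact ⟨h.symm.trans, h.trans⟩

/-- The mean of the centres of mass of the components of a cluster. -/
noncomputable def clusterCenter (M : Link n) (i : Fin n) : E3 :=
  ((M.cluster i).card : ℝ)⁻¹ • ∑ j ∈ M.cluster i, M.center j

/-- g preserves distances, so σ is an automorphism of the adjacency graph and permutes clusters;
averages commute with g. -/
theorem isometry_clusterCenter {M : Link n} {g : E3 ≃ᵢ E3} {σ : Equiv.Perm (Fin n)}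
    (hσ : ∀ i, ∃ ε c, IsSign o ε ∧ ∀ s, g (M.curve i s) = M.curve (σ i) (ε * s + c)) (i : Fin n) :
    g (M.clusterCenter i) = M.clusterCenter (σ i) := by
  have hadj : ∀ {i j}, M.nearGraph.Adj (σ i) (σ j) ↔ M.nearGraph.Adj i j := by
    intro i j
    refine and_congr (σ.injective.ne_iff) ?_
    obtain ⟨ε, c, hε, hi⟩ := hσ i
    obtain ⟨ε', c', hε', hj⟩ := hσ j
    have hnorm : ∀ s t, ‖M.curve i s - M.curve j t‖ =
        ‖M.curve (σ i) (ε * s + c) - M.curve (σ j) (ε' * t + c')‖ := fun s t => by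
      rw [← hi, ← hj, ← linearPart_sub, LinearIsometryEquiv.norm_map]
    constructor
    · rintro ⟨s, t, hst⟩
      refine ⟨ε * (s - c), ε' * (t - c'), ?_⟩
      rw [hnorm, ← mul_assoc, ← mul_assoc, hε.mul_self, hε'.mul_self]
      simpa using hst
    · rintro ⟨s, t, hst⟩
      exact ⟨_, _, (hnorm s t).symm.trans_le hst⟩
  let e : M.nearGraph ≃g M.nearGraph := ⟨σ, hadj⟩
  have hcl : M.cluster (σ i) = (M.cluster i).map σ.toEmbedding := by
    ext k
    obtain ⟨j, rfl⟩ := σ.surjective k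
    rw [mem_cluster, Finset.mem_map_equiv, Equiv.symm_apply_apply, mem_cluster]
    exact e.reachable_iff
  rw [clusterCenter, clusterCenter, isometry_average (M.cluster_nonempty i), hcl,
    Finset.card_map, Finset.sum_map]
  congr 1
  refine Finset.sum_congr rfl fun j _ => ?_
  obtain ⟨ε, c, hε, hc⟩ := hσ j
  exact M.isometry_center hε hc

/-- A link that reaches far away from a fixed point of the group can be pulled closer, by
translating its clusters. -/
theorem exists_isotopicThrough_closer {M : Link n} {v : Fin n → ℝ} (hM : IsInv o G M)
    (hv : M.HasSpeed v) (hT : M.Tube (1 / 2)) {x₀ : E3} (hx₀ : ∀ g ∈ G, g x₀ = x₀) {Λ B ρ : ℝ}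
    (hΛ0 : 0 ≤ Λ) (hΛ : ∀ i, v i ≤ Λ) (hB : B = Λ + n * (4 + Λ)) (hρ : B + 2 * (B + 1) ≤ ρ)
    (hMρ : M.carrier ⊆ Metric.closedBall x₀ ρ) :
    ∃ N : Link n, IsotopicThrough (IsInv o G) M N ∧ N.HasSpeed v ∧ N.Tube (1 / 2) ∧
      N.carrier ⊆ Metric.closedBall x₀ (ρ - 1) := by
  have hB0 : 0 ≤ B := by rw [hB]; positivity
  have hreach : ∀ i j, M.nearGraph.Reachable i j → ∀ s t, ‖M.curve i s - M.curve j t‖ ≤ B := by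
    intro i j h s t
    rw [hB]
    exact norm_sub_le_of_reachable hΛ0 (fun i s t => (hv.norm_sub_le i s t).trans (hΛ i)) h s t
  have hctr : ∀ i s, ‖M.curve i s - M.clusterCenter i‖ ≤ B := fun i s =>
    norm_sub_average_le (M.cluster_nonempty i) fun j hj =>
      M.norm_sub_center_le fun t => hreach i j (mem_cluster.1 hj) s t
  -- With this θ, clusters at distance at least 4 stay at distance at least 2 - 2Bθ ≥ 1, and (1 -
  -- θ)ρ + θB ≤ ρ - 1 because ρ - B ≥ 2(B + 1).
  set θ := 1 / (2 * (B + 1)) with hθ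
  have hθ0 : 0 < θ := by positivity
  have hθB : θ * (2 * (B + 1)) = 1 := by rw [hθ]; field_simp
  have hθ1 : θ ≤ 1 / 2 := by nlinarith
  have hsame : ∀ i j, M.nearGraph.Reachable i j → M.clusterCenter i = M.clusterCenter j :=
    fun i j h => by rw [clusterCenter, clusterCenter, cluster_eq h]
  have hsep : ∀ i j, ¬ M.nearGraph.Reachable i j → ∀ s t, ∀ κ ∈ Icc 0 θ,
      1 ≤ ‖(M.curve i s - κ • (M.clusterCenter i - x₀)) -
        (M.curve j t - κ • (M.clusterCenter j - x₀))‖ := by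
    intro i j hij s t κ hκ
    have h4 : 4 ≤ ‖M.curve i s - M.curve j t‖ := by
      by_contra! hlt
      refine hij (SimpleGraph.Adj.reachable ⟨?_, s, t, hlt.le⟩)
      rintro rfl
      exact hij (SimpleGraph.Reachable.refl i)
    have h1 : (M.curve i s - κ • (M.clusterCenter i - x₀)) -
        (M.curve j t - κ • (M.clusterCenter j - x₀)) =
        (1 - κ) • (M.curve i s - M.curve j t) -
          κ • ((M.clusterCenter i - M.curve i s) + (M.curve j t - M.clusterCenter j)) := by
      module
    have h2 : ‖(M.clusterCenter i - M.curve i s) + (M.curve j t - M.clusterCenter j)‖ ≤ B + B := by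
      refine (norm_add_le _ _).trans (add_le_add ?_ (hctr j t))
      rw [norm_sub_rev]; exact hctr i s
    have h3 := norm_sub_norm_le ((1 - κ) • (M.curve i s - M.curve j t))
      (κ • ((M.clusterCenter i - M.curve i s) + (M.curve j t - M.clusterCenter j)))
    rw [← h1, norm_smul, norm_smul, Real.norm_of_nonneg hκ.1,
      Real.norm_of_nonneg (by linarith [hκ.2])] at h3
    have h5 := mul_le_mul_of_nonneg_left h2 hκ.1
    have h6 : κ * (B + B) ≤ θ * (B + B) := mul_le_mul_of_nonneg_right hκ.2 (by linarith)
    have h7 : 1 / 2 * 4 ≤ (1 - κ) * ‖M.curve i s - M.curve j t‖ :=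
      mul_le_mul (by linarith [hκ.2]) h4 (by norm_num) (by linarith [hκ.2])
    nlinarith
  have hact := hM.exists_action hv
  have hd : ∀ i s, deriv (fun s => M.curve i s - θ • (M.clusterCenter i - x₀)) s =
      deriv (M.curve i) s := fun i s => congrFun (deriv_sub_const_fun _) s
  -- Each cluster is translated towards x₀ by θ times the vector from x₀ to its centre. The motion
  -- is equivariant because g permutes the centres and fixes x₀.
  obtain ⟨N, hN, hiso⟩ := M.exists_isotopicThrough_segment (o := o) (G := G)
    (fun i s => M.curve i s - θ • (M.clusterCenter i - x₀))
    (fun i s => by simp only [M.periodic i s]) (fun i => (M.contDiff i).sub contDiff_const)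
    (fun τ hτ i s => by
      rw [hd, ← add_smul, sub_add_cancel, one_smul]
      exact M.regular i s)
    (fun τ hτ i j s t hst => by
      have h1 : ∀ i s, (1 - τ) • M.curve i s + τ • (M.curve i s - θ • (M.clusterCenter i - x₀)) =
          M.curve i s - (τ * θ) • (M.clusterCenter i - x₀) := fun i s => by module
      rw [h1, h1] at hst
      by_cases hij : M.nearGraph.Reachable i j
      · rw [hsame i j hij] at hst
        exact M.embedded i j s t (sub_left_injective hst)
      · have := hsep i j hij s t (τ * θ) ⟨mul_nonneg hτ.1 hθ0.le, by nlinarith [hτ.2]⟩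
        rw [hst, sub_self, norm_zero] at this
        linarith)
    (fun g hg i => by
      obtain ⟨σ, hσ⟩ := exists_perm_of_action hact hg
      obtain ⟨ε, c, hε, hc⟩ := hσ i
      refine ⟨σ i, ε, c, hε, hc, fun s => ?_⟩
      rw [← hc, ← isometry_clusterCenter hσ i]
      conv_rhs => rw [← hx₀ g hg]
      rw [← linearPart_sub, isometry_apply_eq g (M.curve i s), isometry_apply_eq g (_ - _),
        map_sub, map_smul]
      abel)
  refine ⟨N, hiso, ⟨hv.1, fun i s => by rw [hN, hd, hv.2]⟩, fun i s j t w hw => ?_, ?_⟩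
  · rw [hN] at hw ⊢
    simp only [hd] at hw
    -- Inside a cluster nothing changes relatively; between clusters the distance is at least 1 = 2
    -- · (1/2), so Cauchy–Schwarz suffices.
    by_cases hij : M.nearGraph.Reachable j i
    · simp only [hsame j i hij, sub_sub_sub_cancel_right]
      exact hT i s j t w hw
    · have h1 := hsep j i hij t s θ ⟨hθ0.le, le_rfl⟩
      set q := M.curve j t - θ • (M.clusterCenter j - x₀) -
        (M.curve i s - θ • (M.clusterCenter i - x₀))
      have h2 := real_inner_le_norm q w
      nlinarith [mul_nonneg (mul_nonneg (norm_nonneg q) (norm_nonneg w)) (sub_nonneg.2 h1)]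
  · intro x hx
    obtain ⟨i, s, rfl⟩ := mem_iUnion.1 hx
    have h1 := hMρ (M.curve_mem_carrier i s)
    rw [Metric.mem_closedBall, dist_eq_norm] at h1 ⊢
    rw [hN]
    simp only
    rw [show M.curve i s - θ • (M.clusterCenter i - x₀) - x₀ =
      (1 - θ) • (M.curve i s - x₀) + θ • (M.curve i s - M.clusterCenter i) by module]
    have h2 := norm_add_le ((1 - θ) • (M.curve i s - x₀)) (θ • (M.curve i s - M.clusterCenter i))
    rw [norm_smul, norm_smul, Real.norm_of_nonneg hθ0.le,
      Real.norm_of_nonneg (by linarith)] at h2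
    have h3 := mul_le_mul_of_nonneg_left (hctr i s) hθ0.le
    have h4 := mul_le_mul_of_nonneg_left h1 (show 0 ≤ 1 - θ by linarith)
    have h5 := mul_le_mul_of_nonneg_left hρ hθ0.le
    linarith

/-- Links of bounded length can be moved into a fixed ball. -/
theorem exists_isotopicThrough_bounded {M : Link n} {v : Fin n → ℝ} (hM : IsInv o G M)
    (hv : M.HasSpeed v) (hT : M.Tube (1 / 2)) {x₀ : E3} (hx₀ : ∀ g ∈ G, g x₀ = x₀) {Λ B : ℝ}
    (hΛ0 : 0 ≤ Λ) (hΛ : ∀ i, v i ≤ Λ) (hB : B = Λ + n * (4 + Λ)) :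
    ∃ N : Link n, IsotopicThrough (IsInv o G) M N ∧ N.HasSpeed v ∧ N.Tube (1 / 2) ∧
      N.carrier ⊆ Metric.closedBall x₀ (B + 2 * (B + 1)) := by
  set R := B + 2 * (B + 1) with hR
  -- Each application of the previous lemma shrinks the radius by one, so finitely many reach R.
  have key : ∀ k : ℕ, ∀ M : Link n, IsInv o G M → M.HasSpeed v → M.Tube (1 / 2) →
      M.carrier ⊆ Metric.closedBall x₀ (R + k) →
      ∃ N : Link n, IsotopicThrough (IsInv o G) M N ∧ N.HasSpeed v ∧ N.Tube (1 / 2) ∧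
        N.carrier ⊆ Metric.closedBall x₀ R := by
    intro k
    induction k with
    | zero =>
      intro M hM hv hT hR
      exact ⟨M, (isotopicThrough_iff_joinedIn _ _ _).2 (JoinedIn.refl hM), hv, hT,
        by simpa using hR⟩
    | succ k ih =>
      intro M hM hv hT hc
      have hle : R ≤ R + (k + 1 : ℕ) := le_add_of_nonneg_right (Nat.cast_nonneg _)
      obtain ⟨N, h1, h2, h3, h4⟩ := exists_isotopicThrough_closer hM hv hT hx₀ hΛ0 hΛ hB hle hc
      rw [show R + ((k + 1 : ℕ) : ℝ) - 1 = R + k by push_cast; ring] at h4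
      obtain ⟨N', h5, h6⟩ := ih N h1.right h2 h3 h4
      exact ⟨N', h1.trans h5, h6⟩
  obtain ⟨ρ, hρ⟩ := M.isCompact_carrier.isBounded.subset_closedBall x₀
  obtain ⟨k, hk⟩ := exists_nat_ge (ρ - R)
  exact key k M hM hv hT (hρ.trans (Metric.closedBall_subset_closedBall (by linarith)))

end Link

/-! ### Matching the actions of two close links -/

/-- The midpoint of the convex hull of a bounded set of reals. -/
noncomputable def midrange (S : Set ℝ) : ℝ := (sSup S + sInf S) / 2

/-- Equivariance under reflections as well is the reason to use the midrange: a reflection exchanges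
supremum and infimum. -/
theorem midrange_image {o : Prop} {ε : ℝ} (hε : Link.IsSign o ε) (e : ℝ) {S : Set ℝ}
    (hS : S.Nonempty) (ha : BddAbove S) (hb : BddBelow S) :
    midrange ((fun x => e + ε * x) '' S) = e + ε * midrange S := by
  have hc : Continuous fun x => e + ε * x := by fun_prop
  rcases hε with rfl | ⟨rfl, -⟩
  · have hm : Monotone fun x => e + 1 * x := fun x y h => by simpa using h
    rw [midrange, ← hm.map_csSup_of_continuousAt hc.continuousAt hS ha,
      ← hm.map_csInf_of_continuousAt hc.continuousAt hS hb, midrange]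
    ring
  · have hm : Antitone fun x => e + -1 * x := fun x y h => by simp only; linarith
    rw [midrange, ← hm.map_csSup_of_continuousAt hc.continuousAt hS ha,
      ← hm.map_csInf_of_continuousAt hc.continuousAt hS hb, midrange]
    ring

theorem abs_midrange_le {S : Set ℝ} (hS : S.Nonempty) {η : ℝ} (h : ∀ x ∈ S, |x| ≤ η) :
    |midrange S| ≤ η := by
  obtain ⟨x, hx⟩ := hS
  have h1 : sSup S ≤ η := csSup_le ⟨x, hx⟩ fun y hy => (abs_le.1 (h y hy)).2
  have h2 : -η ≤ sInf S := le_csInf ⟨x, hx⟩ fun y hy => (abs_le.1 (h y hy)).1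
  have h3 : x ≤ sSup S := le_csSup ⟨η, fun y hy => (abs_le.1 (h y hy)).2⟩ hx
  have h4 : sInf S ≤ x := csInf_le ⟨-η, fun y hy => (abs_le.1 (h y hy)).1⟩ hx
  have h5 := abs_le.1 (h x hx)
  rw [midrange]
  exact abs_le.2 ⟨by linarith, by linarith⟩

namespace Link

variable {n : ℕ} {o : Prop} {G : Subgroup (E3 ≃ᵢ E3)}

theorem BiLip.exists_int {N : Link n} {c δ : ℝ} (hN : BiLip c N.curve) (hc : 0 < c) {j : Fin n}
    {x y : ℝ} (h : ‖N.curve j x - N.curve j y‖ ≤ δ) : ∃ k : ℤ, |x - y - k| ≤ δ / c := by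
  refine ⟨round (x - y), ?_⟩
  have h1 := hN.near j y (x + (-round (x - y) : ℤ)) (by
    push_cast
    rw [show x + -(round (x - y) : ℝ) - y = x - y - round (x - y) by ring]
    exact abs_sub_round _)
  rw [N.periodic_int] at h1
  push_cast at h1
  rw [show x + -(round (x - y) : ℝ) - y = x - y - round (x - y) by ring] at h1
  rw [le_div_iff₀ hc]
  linarith

/-- `g` acts on the parameters of `M` and of `N` in the same way up to a small rotation. -/
def ActsNearby (o : Prop) (M N : Link n) (g : E3 ≃ᵢ E3) (i j : Fin n) (ε a d : ℝ) : Prop :=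
  IsSign o ε ∧ (∀ s, g (M.curve i s) = M.curve j (ε * s + a)) ∧
    (∀ s, g (N.curve i s) = N.curve j (ε * s + d)) ∧ |d - a| ≤ 1 / 4

section

variable {M N : Link n} {c δ : ℝ}

/-- The bound 1/4 only selects the representative of d modulo integers. The points of N at d and a
are within δ of each other, both being close to g applied to curve i at 0, so bi-Lipschitzness
improves the bound to δ/c. -/
theorem ActsNearby.abs_sub_le {g : E3 ≃ᵢ E3} {i j : Fin n} {ε a d : ℝ}
    (h : ActsNearby o M N g i j ε a d) (hc : 0 < c) (hN : BiLip c N.curve)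
    (hMN : ∀ i s, ‖M.curve i s - N.curve i s‖ ≤ δ / 2) : |d - a| ≤ δ / c := by
  obtain ⟨-, h1, h2, h3⟩ := h
  have h4 := hN.near j a d (by linarith)
  have h5 := h1 0
  have h6 := h2 0
  rw [mul_zero, zero_add] at h5 h6
  have h7 := norm_add_le (g (N.curve i 0) - g (M.curve i 0)) (M.curve j a - N.curve j a)
  rw [← h5, sub_add_sub_cancel, h6, ← h6, h5, ← h5, ← linearPart_sub,
    LinearIsometryEquiv.norm_map, norm_sub_rev (N.curve i 0), h6, h5] at h7
  rw [le_div_iff₀ hc]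
  linarith [hMN i 0, hMN j a]

/-- Closeness forces equal target components and equal signs. Only unoriented invariance of N
enters, so N inherits preservation of orientation from M. -/
theorem exists_actsNearby {u v : Fin n → ℝ} (hM : IsInv o G M) (hu : M.HasSpeed u)
    (hNi : N.IsInvariant G) (hv : N.HasSpeed v) (hc : 0 < c) (hN : BiLip c N.curve)
    (hMN : ∀ i s, ‖M.curve i s - N.curve i s‖ ≤ δ / 2) (hδ : δ / c ≤ 1 / 16)
    {g : E3 ≃ᵢ E3} (hg : g ∈ G) (i : Fin n) : ∃ j ε a d, ActsNearby o M N g i j ε a d := by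
  obtain ⟨j, ε, a, hε, hj⟩ := hM.exists_action hu g hg i
  obtain ⟨j', ε', b, hε', hj'⟩ :=
    IsInv.exists_action (o := False) ⟨hNi, fun h => h.elim⟩ hv g hg i
  have hclose : ∀ s, ‖N.curve j' (ε' * s + b) - N.curve j (ε * s + a)‖ ≤ δ := by
    intro s
    have h1 := norm_add_le (g (N.curve i s) - g (M.curve i s))
      (M.curve j (ε * s + a) - N.curve j (ε * s + a))
    rw [← linearPart_sub, LinearIsometryEquiv.norm_map, linearPart_sub, ← hj, sub_add_sub_cancel,
      hj', hj, norm_sub_rev (N.curve i s)] at h1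
    linarith [hMN i s, hMN j (ε * s + a)]
  have hδc : δ < c := by
    rw [div_le_iff₀ hc] at hδ
    linarith
  obtain rfl : j' = j := by
    by_contra hne
    linarith [hN.far j' j hne (ε * 0 + a) (ε' * 0 + b), hclose 0]
  obtain ⟨k₀, hk₀⟩ := BiLip.exists_int hN hc (hclose 0)
  -- With opposite signs the parameter difference would change by 1/2 between 0 and 1/4, yet it
  -- stays within 1/16 of integers at both.
  obtain ⟨k₁, hk₁⟩ := BiLip.exists_int hN hc (hclose (1 / 4))
  have hεε : ε' = ε := by
    have h0 := abs_le.1 (hk₀.trans hδ)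
    have h1 := abs_le.1 (hk₁.trans hδ)
    by_contra hne
    have hcases : ε' - ε = 2 ∨ ε' - ε = -2 := by
      rcases hε with rfl | ⟨rfl, -⟩ <;> rcases hε' with rfl | ⟨rfl, -⟩
      · exact absurd rfl hne
      · right; norm_num
      · left; norm_num
      · exact absurd rfl hne
    rcases hcases with h | h
    · have h2 : (0 : ℝ) < k₁ - k₀ := by linarith [h0.1, h0.2, h1.1, h1.2]
      have h3 : (k₁ : ℝ) - k₀ < 1 := by linarith [h0.1, h0.2, h1.1, h1.2]
      have h2 : 0 < k₁ - k₀ := by exact_mod_cast h2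
      have h3 : k₁ - k₀ < 1 := by exact_mod_cast h3
      omega
    · have h2 : (0 : ℝ) < k₀ - k₁ := by linarith [h0.1, h0.2, h1.1, h1.2]
      have h3 : (k₀ : ℝ) - k₁ < 1 := by linarith [h0.1, h0.2, h1.1, h1.2]
      have h2 : 0 < k₀ - k₁ := by exact_mod_cast h2
      have h3 : k₀ - k₁ < 1 := by exact_mod_cast h3
      omega
  subst hεε
  refine ⟨j', ε', a, b - k₀, hε, hj, fun s => ?_, ?_⟩
  · rw [hj', ← N.periodic_int j' (ε' * s + (b - k₀)) k₀]
    congr 1; ring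
  · rw [mul_zero, zero_add, zero_add] at hk₀
    rw [show b - k₀ - a = b - a - k₀ by ring]
    linarith

/-- The displacements between the actions on the parameters of `M` and `N`. -/
def displacements (o : Prop) (G : Subgroup (E3 ≃ᵢ E3)) (M N : Link n) (i : Fin n) : Set ℝ :=
  {u | ∃ g ∈ G, ∃ j ε a d, ActsNearby o M N g i j ε a d ∧ u = ε * (d - a)}

theorem zero_mem_displacements (i : Fin n) : 0 ∈ displacements o G M N i :=
  ⟨1, G.one_mem, i, 1, 0, 0, ⟨Or.inl rfl, fun s => by simp, fun s => by simp, by norm_num⟩,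
    by simp⟩

theorem abs_le_of_mem_displacements (hc : 0 < c) (hN : BiLip c N.curve)
    (hMN : ∀ i s, ‖M.curve i s - N.curve i s‖ ≤ δ / 2) {i : Fin n} {x : ℝ}
    (hx : x ∈ displacements o G M N i) : |x| ≤ δ / c := by
  obtain ⟨g, hg, j, ε, a, d, h, rfl⟩ := hx
  rw [abs_mul, h.1.abs, one_mul]
  exact h.abs_sub_le hc hN hMN

/-- The cocycle rule for the composite f * g. The improved bounds, 1/16 each, keep the composite
below the threshold 1/4. -/
theorem mem_displacements_of_actsNearby (hc : 0 < c) (hN : BiLip c N.curve)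
    (hMN : ∀ i s, ‖M.curve i s - N.curve i s‖ ≤ δ / 2) (hδ : δ / c ≤ 1 / 16) {g : E3 ≃ᵢ E3}
    (hg : g ∈ G) {i j : Fin n} {ε a d : ℝ} (h : ActsNearby o M N g i j ε a d) {x : ℝ}
    (hx : x ∈ displacements o G M N j) : ε * (d - a) + ε * x ∈ displacements o G M N i := by
  obtain ⟨f, hf, k, ε', a', d', h', rfl⟩ := hx
  refine ⟨f * g, G.mul_mem hf hg, k, ε' * ε, ε' * a + a', ε' * d + d',
    ⟨h'.1.mul h.1, fun s => ?_, fun s => ?_, ?_⟩, ?_⟩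
  · rw [IsometryEquiv.mul_apply, h.2.1, h'.2.1]
    congr 1; ring
  · rw [IsometryEquiv.mul_apply, h.2.2.1, h'.2.2.1]
    congr 1; ring
  · rw [show ε' * d + d' - (ε' * a + a') = ε' * (d - a) + (d' - a') by ring]
    refine (abs_add_le _ _).trans ?_
    rw [abs_mul, h'.1.abs, one_mul]
    linarith [h.abs_sub_le hc hN hMN, h'.abs_sub_le hc hN hMN]
  · have := h'.1.mul_self
    linear_combination (-ε * (d - a)) * this

theorem ActsNearby.inv {g : E3 ≃ᵢ E3} {i j : Fin n} {ε a d : ℝ}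
    (h : ActsNearby o M N g i j ε a d) :
    ActsNearby o M N g⁻¹ j i ε (-(ε * a)) (-(ε * d)) := by
  have hε := h.1.mul_self
  have hinv : ∀ x y, g x = y → g⁻¹ y = x := fun x y hxy => by
    rw [← hxy]; exact g.symm_apply_apply x
  refine ⟨h.1, fun s => hinv _ _ ?_, fun s => hinv _ _ ?_, ?_⟩
  · rw [h.2.1]
    congr 1; linear_combination (s - a) * hε
  · rw [h.2.2.1]
    congr 1; linear_combination (s - d) * hε
  · rw [show -(ε * d) - -(ε * a) = -(ε * (d - a)) by ring, abs_neg, abs_mul, h.1.abs, one_mul]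
    exact h.2.2.2

/-- Composition with g and with its inverse identifies the displacements at i with an affine image
of those at j. The midrange therefore exhibits the cocycle as a coboundary. -/
theorem ActsNearby.midrange_eq (hc : 0 < c) (hN : BiLip c N.curve)
    (hMN : ∀ i s, ‖M.curve i s - N.curve i s‖ ≤ δ / 2) (hδ : δ / c ≤ 1 / 16) {g : E3 ≃ᵢ E3}
    (hg : g ∈ G) {i j : Fin n} {ε a d : ℝ} (h : ActsNearby o M N g i j ε a d) :
    midrange (displacements o G M N i) =
      ε * (d - a) + ε * midrange (displacements o G M N j) := by
  have hb : ∀ x ∈ displacements o G M N j, |x| ≤ δ / c := fun x hx =>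
    abs_le_of_mem_displacements hc hN hMN hx
  rw [← midrange_image h.1 _ ⟨0, zero_mem_displacements j⟩
    ⟨δ / c, fun x hx => (abs_le.1 (hb x hx)).2⟩ ⟨-(δ / c), fun x hx => (abs_le.1 (hb x hx)).1⟩]
  congr 1
  ext x
  constructor
  · intro hx
    refine ⟨_, mem_displacements_of_actsNearby hc hN hMN hδ (G.inv_mem hg) h.inv hx, ?_⟩
    have := h.1.mul_self
    simp only
    linear_combination (ε * a - ε * d + x) * this
  · rintro ⟨y, hy, rfl⟩
    exact mem_displacements_of_actsNearby hc hN hMN hδ hg h hy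

/-- Invariant links with components of constant speed that are `C¹`-close are isotopic. -/
theorem isotopicThrough_of_close {u v : Fin n → ℝ} (hM : IsInv o G M) (hu : M.HasSpeed u)
    (hNi : N.IsInvariant G) (hv : N.HasSpeed v) (hc : 0 < c) (hMbi : BiLip c M.curve)
    (hN : BiLip c N.curve) {Λ K : ℝ} (hΛ : ∀ i, v i ≤ Λ) (hΛ0 : 0 ≤ Λ) (hK0 : 0 ≤ K)
    (hK : ∀ i s t, ‖deriv (N.curve i) t - deriv (N.curve i) s‖ ≤ K * |t - s|)
    (hMN : C1Close δ M.curve N.curve) (hδ : δ / c ≤ 1 / 16)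
    (hδ' : δ + (2 * Λ + K) * (δ / c) < c) : IsotopicThrough (IsInv o G) M N := by
  have hact := fun g hg i => exists_actsNearby (g := g) hM hu hNi hv hc hN hMN.pos hδ hg i
  have hNinv : IsInv o G N := isInv_of_action fun g hg i => by
    obtain ⟨j, ε, a, d, h⟩ := hact g hg i
    exact ⟨j, ε, d, h.1, h.2.2.1⟩
  -- The shift by m satisfies ε m i + d = a + m j, so the shifted N has exactly the action of M.
  set m : Fin n → ℝ := fun i => -midrange (displacements o G M N i) with hm
  have hmη : ∀ i, |m i| ≤ δ / c := fun i => by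
    rw [hm, abs_neg]
    exact abs_midrange_le ⟨0, zero_mem_displacements i⟩ fun x hx =>
      abs_le_of_mem_displacements hc hN hMN.pos hx
  have hφ : IsReparam fun (i : Fin n) s => s + m i :=
    ⟨fun i => contDiff_id.add contDiff_const, fun i s => by simp,
      fun i s => by ring⟩
  set N' := N.reparam _ hφ with hN'
  have hcurve : ∀ i s, N'.curve i s = N.curve i (s + m i) := fun i s => rfl
  have hder : ∀ i s, deriv (N'.curve i) s = deriv (N.curve i) (s + m i) := fun i s =>
    deriv_comp_add_const _ _ _
  -- Shifting by at most δ/c costs Λδ/c in position and Kδ/c in derivative; Λ is doubled because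
  -- `C1Close` halves the position bound.
  have hclose : C1Close (δ + (2 * Λ + K) * (δ / c)) M.curve N'.curve := by
    have hη0 : ∀ i : Fin n, 0 ≤ δ / c := fun i => (abs_nonneg _).trans (hmη i)
    constructor
    · intro i s
      have h1 := norm_sub_le_of_norm_deriv_le (N.differentiable_curve i)
        (fun x => (hv.2 i x).trans_le (hΛ i)) (s + m i) s
      rw [sub_add_cancel_left, abs_neg] at h1
      have h2 := norm_add_le (M.curve i s - N.curve i s) (N.curve i s - N.curve i (s + m i))
      rw [sub_add_sub_cancel] at h2
      have h3 := mul_le_mul_of_nonneg_left (hmη i) hΛ0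
      have h4 := mul_nonneg hK0 (hη0 i)
      rw [hcurve]
      linarith [hMN.pos i s]
    · intro i s
      have h1 := hK i (s + m i) s
      rw [sub_add_cancel_left, abs_neg] at h1
      have h2 := norm_add_le (deriv (M.curve i) s - deriv (N.curve i) s)
        (deriv (N.curve i) s - deriv (N.curve i) (s + m i))
      rw [sub_add_sub_cancel] at h2
      have h3 := mul_le_mul_of_nonneg_left (hmη i) hK0
      have h4 := mul_nonneg hΛ0 (hη0 i)
      rw [hder]
      linarith [hMN.deriv i s]
  obtain ⟨N'', hN'', hiso, -⟩ := M.exists_isotopicThrough_of_close (o := o) (G := G) N'.curve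
    N'.periodic N'.contDiff hMbi hclose hδ' (fun g hg i => by
      obtain ⟨j, ε, a, d, h⟩ := hact g hg i
      refine ⟨j, ε, a, h.1, h.2.1, fun s => ?_⟩
      rw [hcurve, hcurve, h.2.2.1]
      congr 1
      have h1 := h.midrange_eq hc hN hMN.pos hδ hg
      have h2 := h.1.mul_self
      simp only [hm]
      rw [h1]
      linear_combination (-(d - a) - midrange (displacements o G M N j)) * h2)
  rw [eq_of_curve_eq hN''] at hiso
  exact hiso.trans (hNinv.isotopicThrough_reparam _ hφ).symm

end

end Link

/-! ### Compactness: limits of thick invariant links -/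

theorem exists_ultrafilter_limit {ι X : Type*} [TopologicalSpace X] (U : Ultrafilter ι)
    {K : Set X} (hK : IsCompact K) {f : ι → X} (hf : ∀ k, f k ∈ K) :
    ∃ x ∈ K, Tendsto f U (𝓝 x) :=
  hK.ultrafilter_le_nhds (U.map f) (le_principal_iff.2 (mem_map.2 (univ_mem' hf)))

theorem hasDerivAt_of_norm_sub_le {f : ℝ → E3} {f' : E3} {s K : ℝ}
    (h : ∀ t, ‖f t - f s - (t - s) • f'‖ ≤ K * |t - s| * |t - s|) : HasDerivAt f f' s := by
  rw [hasDerivAt_iff_isLittleO]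
  refine Asymptotics.IsBigO.trans_isLittleO (g := fun t => ‖t - s‖ ^ 2) ?_
    (Asymptotics.isLittleO_pow_sub_sub s one_lt_two)
  refine Asymptotics.IsBigO.of_bound K (Eventually.of_forall fun t => ?_)
  rw [norm_pow, norm_norm, Real.norm_eq_abs, sq, ← mul_assoc]
  exact h t

/-- Pointwise convergence of uniformly Lipschitz periodic curves is uniform. -/
theorem eventually_forall_norm_sub_le {ι : Type*} {l : Filter ι} {f : ι → ℝ → E3} {F : ℝ → E3}
    {K : ℝ} (hK : 0 ≤ K) (hf : ∀ k s t, ‖f k t - f k s‖ ≤ K * |t - s|)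
    (hF : ∀ s t, ‖F t - F s‖ ≤ K * |t - s|) (hfp : ∀ k, Function.Periodic (f k) 1)
    (hFp : Function.Periodic F 1) (hlim : ∀ s, Tendsto (fun k => f k s) l (𝓝 (F s))) {δ : ℝ}
    (hδ : 0 < δ) : ∀ᶠ k in l, ∀ s, ‖f k s - F s‖ ≤ δ := by
  -- On the net of mesh 1/m the Lipschitz error is at most δ/3 for each curve, leaving δ/3 for
  -- convergence at the net points.
  obtain ⟨m, hm⟩ := exists_nat_gt (3 * K / δ)
  have hm0 : (0 : ℝ) < m := lt_of_le_of_lt (by positivity) hm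
  rw [div_lt_iff₀ hδ] at hm
  have hnet : ∀ᶠ k in l, ∀ j ∈ Finset.range m, ‖f k (j / m) - F (j / m)‖ < δ / 3 := by
    rw [Finset.eventually_all]
    intro j _
    have := (tendsto_iff_norm_sub_tendsto_zero.1 (hlim (j / m)))
    exact this.eventually_lt_const (by positivity)
  filter_upwards [hnet] with k hk s
  have hred : ∀ {g : ℝ → E3}, Function.Periodic g 1 → g (Int.fract s) = g s := fun {g} hg => by
    rw [Int.fract]
    simpa using hg.sub_int_mul_eq ⌊s⌋ (x := s)
  rw [← hred (hfp k), ← hred hFp]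
  set x := Int.fract s
  have hx0 : 0 ≤ x := Int.fract_nonneg s
  have hx1 : x < 1 := Int.fract_lt_one s
  set j := ⌊x * m⌋₊
  have hj1 : (j : ℝ) ≤ x * m := Nat.floor_le (by positivity)
  have hj2 : x * m < j + 1 := Nat.lt_floor_add_one _
  have hjm : j < m := by
    have : (j : ℝ) < m := by nlinarith
    exact_mod_cast this
  have hxj : |x - j / m| ≤ 1 / m := by
    rw [abs_of_nonneg (sub_nonneg.2 ((div_le_iff₀ hm0).2 hj1)), sub_le_iff_le_add, ← add_div,
      le_div_iff₀ hm0]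
    linarith
  have hKm : K * |x - j / m| ≤ δ / 3 := by
    refine (mul_le_mul_of_nonneg_left hxj hK).trans ?_
    rw [mul_one_div, div_le_iff₀ hm0]
    linarith
  have h1 := hf k (j / m) x
  have h2 := hF (j / m) x
  have h3 := hk j (Finset.mem_range.2 hjm)
  have h4 := norm_add₃_le (a := f k x - f k (j / m)) (b := f k (j / m) - F (j / m))
    (c := F (j / m) - F x)
  rw [sub_add_sub_cancel, sub_add_sub_cancel, norm_sub_rev (F _)] at h4
  linarith

namespace Link

variable {n : ℕ} {o : Prop} {G : Subgroup (E3 ≃ᵢ E3)}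

/-- A normal w of the limit need not be normal to M k; its projection to the normal plane of M k is,
and converges to w. -/
theorem tube_of_tendsto {ι : Type*} {l : Filter ι} [l.NeBot] {M : ι → Link n} {N : Link n} {r : ℝ}
    (hM : ∀ k, (M k).Tube r)
    (h : ∀ i s, Tendsto (fun k => (M k).curve i s) l (𝓝 (N.curve i s)))
    (h' : ∀ i s, Tendsto (fun k => deriv ((M k).curve i) s) l (𝓝 (deriv (N.curve i) s))) :
    N.Tube r := by
  intro i s j t w hw
  have hTT : (inner ℝ (deriv (N.curve i) s) (deriv (N.curve i) s) : ℝ) ≠ 0 :=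
    inner_self_ne_zero.2 (N.regular i s)
  have hwk : Tendsto (fun k => w - ((inner ℝ (deriv ((M k).curve i) s) w : ℝ) /
      inner ℝ (deriv ((M k).curve i) s) (deriv ((M k).curve i) s)) • deriv ((M k).curve i) s) l
      (𝓝 w) := by
    have h1 := ((((h' i s).inner (𝕜 := ℝ) (tendsto_const_nhds (x := w))).div
      ((h' i s).inner (𝕜 := ℝ) (h' i s)) hTT).smul (h' i s)).const_sub w
    rw [hw, zero_div, zero_smul, sub_zero] at h1
    exact h1
  have hq : Tendsto (fun k => (M k).curve j t - (M k).curve i s) l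
      (𝓝 (N.curve j t - N.curve i s)) := (h j t).sub (h i s)
  refine le_of_tendsto_of_tendsto' ((hq.inner (𝕜 := ℝ) hwk).const_mul (2 * r))
    ((hq.norm.pow 2).mul hwk.norm) fun k => hM k i s j t _ ?_
  rw [inner_sub_right, real_inner_smul_right,
    div_mul_cancel₀ _ (inner_self_ne_zero.2 ((M k).regular i s)), sub_self]

/-- Limits of invariant links of constant speed, bounded length and thickness at least one. -/
theorem exists_limit (M : ℕ → Link n) (v : ℕ → Fin n → ℝ) (hM : ∀ k, IsInv o G (M k))
    (hv : ∀ k, (M k).HasSpeed (v k)) (hT : ∀ k, (M k).Tube (1 / 2)) {Λ R : ℝ} (hΛ0 : 0 ≤ Λ)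
    (hΛ : ∀ k i, v k i ≤ Λ) {x₀ : E3} (hR : ∀ k, (M k).carrier ⊆ Metric.closedBall x₀ R) :
    ∃ (N : Link n) (w : Fin n → ℝ) (l : Filter ℕ), l.NeBot ∧ l ≤ atTop ∧ N.HasSpeed w ∧
      (∀ i, Tendsto (fun k => v k i) l (𝓝 (w i))) ∧ N.Tube (1 / 2) ∧
      ∃ k, IsotopicThrough (IsInv o G) (M k) N := by
  -- A nonprincipal ultrafilter replaces subsequences: all pointwise limits exist at once, and the
  -- Lipschitz bounds make the convergence uniform.
  let U : Ultrafilter ℕ := hyperfilter ℕ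
  -- This is 4Λ²/r at r = 1/2; likewise 1/16 below is r/8.
  set K := 8 * Λ ^ 2 with hKdef
  have hK0 : 0 ≤ K := by positivity
  have hbi : ∀ k, BiLip (1 / 16) (M k).curve := fun k => by
    have := (hT k).biLip (by norm_num) (hv k)
    norm_num at this ⊢
    exact this
  have hlip : ∀ k i s t, ‖(M k).curve i t - (M k).curve i s‖ ≤ Λ * |t - s| := fun k i =>
    norm_sub_le_of_norm_deriv_le ((M k).differentiable_curve i)
      fun x => ((hv k).2 i x).trans_le (hΛ k i)
  have hlip' : ∀ k i s t,
      ‖deriv ((M k).curve i) t - deriv ((M k).curve i) s‖ ≤ K * |t - s| := fun k i s t => by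
    refine ((hT k).norm_deriv_sub_le (by norm_num) (hv k) i s t).trans
      (mul_le_mul_of_nonneg_right ?_ (abs_nonneg _))
    have := pow_le_pow_left₀ ((hv k).1 i).le (hΛ k i) 2
    rw [hKdef]
    linarith
  have hquad : ∀ k i s t, ‖(M k).curve i t - (M k).curve i s -
      (t - s) • deriv ((M k).curve i) s‖ ≤ K * |t - s| * |t - s| := fun k i s t =>
    norm_sub_sub_smul_le ((M k).differentiable_curve i) fun x hx => (hlip' k i s x).trans
      (mul_le_mul_of_nonneg_left (abs_sub_left_of_mem_uIcc hx) hK0)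
  have hγ := fun i s => exists_ultrafilter_limit U (isCompact_closedBall x₀ R)
    (f := fun k => (M k).curve i s) fun k => hR k ((M k).curve_mem_carrier i s)
  have hγ' := fun i s => exists_ultrafilter_limit U (isCompact_closedBall (0 : E3) Λ)
    (f := fun k => deriv ((M k).curve i) s) fun k => by
      rw [mem_closedBall_zero_iff, (hv k).2]; exact hΛ k i
  have hw := fun i => exists_ultrafilter_limit U (isCompact_Icc (a := (0 : ℝ)) (b := Λ))
    (f := fun k => v k i) fun k => ⟨((hv k).1 i).le, hΛ k i⟩
  choose γ _ hγ using hγ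
  choose γ' _ hγ' using hγ'
  choose w _ hw using hw
  -- The uniform quadratic Taylor estimate survives the limit and identifies γ' as the derivative of
  -- γ.
  have hder : ∀ i s, HasDerivAt (γ i) (γ' i s) s := fun i s =>
    hasDerivAt_of_norm_sub_le fun t => le_of_tendsto'
      (((hγ i t).sub (hγ i s)).sub ((hγ' i s).const_smul (t - s))).norm fun k => hquad k i s t
  have hdereq : ∀ i, deriv (γ i) = γ' i := fun i => funext fun s => (hder i s).deriv
  have hγlip : ∀ i s t, ‖γ i t - γ i s‖ ≤ Λ * |t - s| := fun i s t =>
    le_of_tendsto' ((hγ i t).sub (hγ i s)).norm fun k => hlip k i s t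
  have hγ'lip : ∀ i s t, ‖γ' i t - γ' i s‖ ≤ K * |t - s| := fun i s t =>
    le_of_tendsto' ((hγ' i t).sub (hγ' i s)).norm fun k => hlip' k i s t
  have hper : ∀ i, Function.Periodic (γ i) 1 := fun i s =>
    tendsto_nhds_unique (hγ i (s + 1)) ((hγ i s).congr fun k => ((M k).periodic i s).symm)
  have hγbi : BiLip (1 / 16) γ :=
    ⟨fun i s t hst => ge_of_tendsto' ((hγ i t).sub (hγ i s)).norm fun k => (hbi k).near i s t hst,
      fun i j hij s t => ge_of_tendsto' ((hγ i t).sub (hγ j s)).norm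
        fun k => (hbi k).far i j hij s t⟩
  have hdiff : ∀ i, Differentiable ℝ (γ i) := fun i s => (hder i s).differentiableAt
  have hpos := hγbi.le_norm_deriv hdiff
  have hcont' : ∀ i, Continuous (γ' i) := fun i =>
    (LipschitzWith.of_dist_le_mul (K := ⟨K, hK0⟩) fun s t => by
      rw [dist_eq_norm, Real.dist_eq]; exact hγ'lip i t s).continuous
  let N : Link n :=
    { curve := γ
      periodic := hper
      contDiff := fun i => contDiff_one_iff_deriv.2 ⟨hdiff i, by rw [hdereq]; exact hcont' i⟩
      regular := fun i s => norm_pos_iff.1 (lt_of_lt_of_le (by norm_num) (hpos i s))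
      embedded := hγbi.embedded (by norm_num) hper }
  have hNder : ∀ i s, deriv (N.curve i) s = γ' i s := fun i s => (hder i s).deriv
  have hspeed : ∀ i s, ‖γ' i s‖ = w i := fun i s =>
    tendsto_nhds_unique (hγ' i s).norm ((hw i).congr fun k => ((hv k).2 i s).symm)
  have hNv : N.HasSpeed w :=
    ⟨fun i => by
      rw [← hspeed i 0, ← hNder]
      exact lt_of_lt_of_le (by norm_num) (hpos i 0), fun i s => by rw [hNder, hspeed]⟩
  have hwΛ : ∀ i, w i ≤ Λ := fun i => le_of_tendsto' (hw i) fun k => hΛ k i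
  -- Only the point set is treated here; the sign condition for N is recovered later from closeness
  -- to M k.
  have hNi : N.IsInvariant G := by
    refine isInvariant_of_subset fun g hg => ?_
    rintro _ ⟨x, hx, rfl⟩
    obtain ⟨i, s, rfl⟩ := mem_iUnion.1 hx
    have hk : ∀ k, g ((M k).curve i s) ∈ (M k).carrier := fun k => by
      rw [← (hM k).1 g hg]
      exact mem_image_of_mem _ ((M k).curve_mem_carrier i s)
    choose j t ht hjt using fun k => (M k).exists_near 0 (hk k)
    obtain ⟨j₀, -, hj₀⟩ := exists_ultrafilter_limit U isCompact_univ (f := j) fun k => trivial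
    obtain ⟨t₀, -, ht₀⟩ := exists_ultrafilter_limit U isCompact_Icc ht
    rw [nhds_discrete, tendsto_pure] at hj₀
    have h1 : Tendsto (fun k => g ((M k).curve i s)) U (𝓝 (g (N.curve i s))) :=
      (g.continuous.tendsto _).comp (hγ i s)
    have h2 : Tendsto (fun k => (M k).curve j₀ (t k)) U (𝓝 (N.curve j₀ t₀)) := by
      refine (hγ j₀ t₀).congr_dist ?_
      have h3 : Tendsto (fun k => Λ * |t₀ - t k|) U (𝓝 0) := by
        simpa using ((ht₀.const_sub t₀).abs).const_mul Λ
      refine squeeze_zero (fun k => dist_nonneg) (fun k => ?_) h3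
      rw [dist_eq_norm]
      exact hlip k j₀ (t k) t₀
    have h3 : g (N.curve i s) = N.curve j₀ t₀ := by
      refine tendsto_nhds_unique h1 (h2.congr' ?_)
      filter_upwards [hj₀] with k hk
      rw [hjt, hk]
    rw [h3]
    exact N.curve_mem_carrier _ _
  obtain ⟨δ, hδ0, hδ1, hδ2⟩ : ∃ δ : ℝ, 0 < δ ∧ δ / (1 / 16) ≤ 1 / 16 ∧
      δ + (2 * Λ + K) * (δ / (1 / 16)) < 1 / 16 := by
    refine ⟨1 / (1000 * (1 + (2 * Λ + K))), by positivity, ?_, ?_⟩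
    · rw [div_div, div_le_div_iff₀ (by positivity) (by norm_num)]
      nlinarith
    · rw [show (1 / (1000 * (1 + (2 * Λ + K))) + (2 * Λ + K) *
        (1 / (1000 * (1 + (2 * Λ + K))) / (1 / 16)) : ℝ) =
        (1 + (2 * Λ + K) * 16) / (1000 * (1 + (2 * Λ + K))) by field_simp,
        div_lt_div_iff₀ (by positivity) (by norm_num)]
      nlinarith
  have hclose : ∀ᶠ k in (U : Filter ℕ), C1Close δ (M k).curve N.curve := by
    have h1 : ∀ᶠ k in (U : Filter ℕ), ∀ i s, ‖(M k).curve i s - γ i s‖ ≤ δ / 2 :=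
      eventually_all.2 fun i => eventually_forall_norm_sub_le hΛ0 (fun k => hlip k i) (hγlip i)
        (fun k => (M k).periodic i) (hper i) (hγ i) (half_pos hδ0)
    have h2 : ∀ᶠ k in (U : Filter ℕ), ∀ i s, ‖deriv ((M k).curve i) s - γ' i s‖ ≤ δ :=
      eventually_all.2 fun i => eventually_forall_norm_sub_le hK0 (fun k => hlip' k i) (hγ'lip i)
        (fun k => periodic_deriv ((M k).periodic i))
        (by rw [← hdereq]; exact periodic_deriv (hper i)) (hγ' i) hδ0
    filter_upwards [h1, h2] with k h1 h2
    exact ⟨h1, fun i s => by rw [hNder]; exact h2 i s⟩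
  obtain ⟨k, hk⟩ := hclose.exists
  refine ⟨N, w, U, inferInstance, Nat.hyperfilter_le_atTop, hNv, hw,
    tube_of_tendsto hT hγ (fun i s => by rw [hNder]; exact hγ' i s), k, ?_⟩
  exact isotopicThrough_of_close (hM k) (hv k) hNi hNv (by norm_num) (hbi k) hγbi hwΛ hΛ0 hK0
    (fun i s t => by rw [hNder, hNder]; exact hγ'lip i s t) hk hδ1 hδ2

/-! ### The minimizer -/

/-- `Tube` refers to a parametrization, but it is equivalent to a bound on thickness, which sees
only the point set. -/
theorem tube_of_carrier_eq (hn : 1 ≤ n) {M N : Link n} (h : N.carrier = M.carrier)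
    (hM : M.Tube (1 / 2)) : N.Tube (1 / 2) := by
  rw [← one_le_thickness_iff_tube _ hn, Link.thickness] at hM ⊢
  rwa [h]

theorem length_nonneg (L : Link n) : 0 ≤ L.length :=
  Finset.sum_nonneg fun _ _ =>
    intervalIntegral.integral_nonneg zero_le_one fun _ _ => norm_nonneg _

/-- Existence of length minimizers of thickness at least one in the isotopy class of an invariant
link. -/
theorem IsInv.exists_minimizer (hn : 1 ≤ n) {L : Link n} (hL : IsInv o G L) :
    ∃ L₀ ∈ {M | IsotopicThrough (IsInv o G) L M ∧ 1 ≤ M.thickness},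
      ∀ L' ∈ {M | IsotopicThrough (IsInv o G) L M ∧ 1 ≤ M.thickness}, L₀.length ≤ L'.length := by
  simp only [one_le_thickness_iff_tube _ hn]
  set S : Set (Link n) := {M | IsotopicThrough (IsInv o G) L M ∧ M.Tube (1 / 2)} with hS
  obtain ⟨N₀, hN₀⟩ := exists_isotopicThrough_tube hn hL
  obtain ⟨M₁, v₁, hM₁, -, hv₁, -⟩ := hL.exists_hasSpeed
  -- The fixed point depends on G only in its defining property, so one x₀ serves the whole
  -- minimizing sequence.
  obtain ⟨x₀, hx₀⟩ := exists_fixedPoint hn (hM₁.right.exists_action hv₁)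
  have hne : (Link.length '' S).Nonempty := ⟨_, N₀, hN₀, rfl⟩
  have hbdd : BddBelow (Link.length '' S) := ⟨0, by
    rintro _ ⟨M, -, rfl⟩
    exact M.length_nonneg⟩
  set ℓ := sInf (Link.length '' S) with hℓ
  have hℓ0 : 0 ≤ ℓ := le_csInf hne (by
    rintro _ ⟨M, -, rfl⟩
    exact M.length_nonneg)
  have hseq : ∀ k : ℕ, ∃ (M : Link n) (v : Fin n → ℝ), IsotopicThrough (IsInv o G) L M ∧
      M.HasSpeed v ∧ M.Tube (1 / 2) ∧ (∀ i, v i ≤ ℓ + 1) ∧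
      M.carrier ⊆ Metric.closedBall x₀ ((ℓ + 1 + n * (4 + (ℓ + 1))) +
        2 * ((ℓ + 1 + n * (4 + (ℓ + 1))) + 1)) ∧ ∑ i, v i < ℓ + 1 / (k + 1) := by
    intro k
    obtain ⟨_, ⟨M, hM, rfl⟩, hlt⟩ := exists_lt_of_csInf_lt hne
      (show ℓ < ℓ + 1 / ((k : ℝ) + 1) from lt_add_of_pos_right _ (by positivity))
    obtain ⟨M', v, h1, h2, h3, h4⟩ := hM.1.right.exists_hasSpeed
    have h5 : ∑ i, v i < ℓ + 1 / ((k : ℝ) + 1) := by rwa [← h3.length_eq, h4]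
    have h6 : ∀ i, v i ≤ ℓ + 1 := fun i => by
      have h7 := Finset.single_le_sum (fun i _ => (h3.1 i).le) (Finset.mem_univ i)
      have h8 : 1 / ((k : ℝ) + 1) ≤ 1 := by
        rw [div_le_one (by positivity)]
        linarith [(Nat.cast_nonneg k : (0 : ℝ) ≤ k)]
      linarith
    obtain ⟨N, h7, h8, h9, h10⟩ := exists_isotopicThrough_bounded h1.right h3
      (tube_of_carrier_eq hn h2 hM.2) hx₀ (by linarith) h6 rfl
    exact ⟨N, v, (hM.1.trans h1).trans h7, h8, h9, h6, h10, h5⟩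
  choose M v hM hv hT hΛ hR hlen using hseq
  obtain ⟨N, w, l, hl, hle, hNv, hw, hNT, k, hk⟩ := exists_limit M v (fun k => (hM k).right) hv hT
    (by linarith) hΛ hR
  refine ⟨N, ⟨(hM k).trans hk, hNT⟩, fun L' hL' => ?_⟩
  -- At constant speed the length is the sum of the speeds, and these converge.
  have h1 : N.length ≤ ℓ := by
    rw [hNv.length_eq]
    have h2 : Tendsto (fun k : ℕ => ℓ + 1 / ((k : ℝ) + 1)) l (𝓝 (ℓ + 0)) :=
      (tendsto_one_div_add_atTop_nhds_zero_nat.mono_left hle).const_add ℓ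
    rw [add_zero] at h2
    exact le_of_tendsto_of_tendsto' (tendsto_finsetSum _ fun i _ => hw i) h2 fun k => (hlen k).le
  exact h1.trans (csInf_le hbdd ⟨L', hL', rfl⟩)

theorem isInv_false : (IsInv False G : Link n → Prop) = fun M => M.IsInvariant G :=
  funext fun _ => propext ⟨fun h => h.1, fun h => ⟨h, fun f => f.elim⟩⟩

theorem isInv_true : (IsInv True G : Link n → Prop) = fun M => M.IsOrientedInvariant G :=
  funext fun _ => propext ⟨fun h => ⟨h.1, h.2 trivial⟩, fun h => ⟨h.1, fun _ => h.2⟩⟩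

end Link

theorem mainTheorem8 (n : ℕ) (hn : 1 ≤ n) (G : Subgroup (E3 ≃ᵢ E3))
    (hG : IsCompactIsometryGroup G) (L : Link n) :
    (L.IsInvariant G →
      ∃ L₀ ∈ {M ∈ Link.symmetricLinkType G L | 1 ≤ M.thickness},
        ∀ L' ∈ {M ∈ Link.symmetricLinkType G L | 1 ≤ M.thickness}, L₀.length ≤ L'.length) ∧
    (L.IsOrientedInvariant G →
      ∃ L₀ ∈ {M ∈ Link.orientedSymmetricLinkType G L | 1 ≤ M.thickness},
        ∀ L' ∈ {M ∈ Link.orientedSymmetricLinkType G L | 1 ≤ M.thickness},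
          L₀.length ≤ L'.length) := by
  constructor
  · intro h
    have hL : Link.IsInv False G L := by rw [Link.isInv_false]; exact h
    have := hL.exists_minimizer hn
    rw [Link.isInv_false] at this
    exact this
  · intro h
    have hL : Link.IsInv True G L := by rw [Link.isInv_true]; exact h
    have := hL.exists_minimizer hn
    rw [Link.isInv_true] at this
    exact this
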